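/- There is a universal constant $C<\infty$ such that every vertex-weighted planar graph has maximal Markov type $2$ with $M_2^*\le C$. Here a vertex-weighted graph is a (multi)graph $G$ with vertex set $\mathcal V(G)$ together with a function $\omega:\mathcal V(G)\to[0,\infty)$, considered with the weighted graph distance $$\operatorname{dist}^G_\omega(v,w)=\inf_P\sum_{i=1}^{|P|}\tfrac12\bigl(\omega(P(i))+\omega(P(i-1))\bigr),$$ where the infimum is over all finite paths $P$ from $v$ to $w$, i.e. functions $P:\{0,\dots,n\}\to\mathcal V(G)$ with $n=|P|\ge 0$, $P(0)=v$, $P(n)=w$ such that $P(i-1)$ and $P(i)$ are equal or joined by an edge for $1\le i\le n$ (so $\operatorname{dist}^G_\omega(v,w)=\infty$ if $v$ and $w$ are not connected, and the distance may vanish between distinct vertices). The graph is planar if it can be drawn in the plane with distinct points as vertices and simple arcs (simple closed curves, for loops) as edges, such that the interior of an edge meets no vertex and no other edge. A (pseudo-)metric space $(\mathbb X,d)$, where the value $d=\infty$ is allowed, has maximal Markov type $p$ if there is a constant $C<\infty$ such that for every finite set $S$, every transition matrix $P$ of an irreducible reversible Markov chain on $S$, every function $\phi:S\to\mathbb X$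 and every $n\ge 0$, $$\mathbb E\Bigl[\max_{0\le m\le n} d\bigl(\phi(X_0),\phi(X_m)\bigr)^p\Bigr]\le C^p\,n\,\mathbb E\Bigl[d\bigl(\phi(X_0),\phi(X_1)\bigr)^p\Bigr],$$ where $(X_m)_{m\ge 0}$ is the Markov chain with transition matrix $P$ and $X_0$ distributed according to the stationary measure of $P$ (with the convention $0\cdot\infty=0$). The infimum of all such constants $C$ is denoted by $M_p^*(\mathbb X)$. -/

import Mathlib

open scoped NNReal ENNReal Graph

/-! ### Stationary reversible Markov chains on a finite set -/

/-- `P` is the transition matrix of an irreducible Markov chain on the finite set `S`, and the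
chain is reversible with respect to the probability vector `π` (detailed balance); `π` is then the
unique stationary distribution of `P`. -/
structure IsIrreducibleReversible {S : Type*} [Fintype S] [DecidableEq S]
    (P : Matrix S S ℝ) (π : S → ℝ) : Prop where
  stochastic : P ∈ Matrix.rowStochastic ℝ S
  irreducible : P.IsIrreducible
  prob : π ∈ stdSimplex ℝ S
  detailed_balance : ∀ s t, π s * P s t = π t * P t s

/-- The process `X` is, under `μ`, a Markov chain with initial distribution `π` and transition
matrix `P`:
`μ (X 0 = x 0, …, X n = x n) = π (x 0) * P (x 0) (x 1) * ⋯ * P (x (n - 1)) (x n)`. -/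
structure IsMarkovChain {S : Type*} {Ω : Type*} [MeasurableSpace Ω]
    (π : S → ℝ) (P : Matrix S S ℝ) (μ : MeasureTheory.Measure Ω) (X : ℕ → Ω → S) : Prop where
  measurable : ∀ n s, MeasurableSet {ω | X n ω = s}
  law : ∀ (n : ℕ) (x : ℕ → S), μ {ω | ∀ i ≤ n, X i ω = x i} =
    ENNReal.ofReal (π (x 0) * ∏ i ∈ Finset.range n, P (x i) (x (i + 1)))

/-! ### Maximal Markov type -/

/-- The maximal Markov type `p` inequality with constant `C`:
`E [max_{0 ≤ m ≤ n} d(φ(X₀), φ(X_m))^p] ≤ C^p n E [d(φ(X₀), φ(X₁))^p]`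
for every stationary reversible irreducible finite Markov chain `X`, every map `φ` from its state
space to `E` and every `n ≥ 0`. -/
def HasMaximalMarkovTypeWith (E : Type*) [PseudoEMetricSpace E] (p : ℝ) (C : ℝ≥0) : Prop :=
  ∀ (S : Type) [Fintype S] [DecidableEq S] (P : Matrix S S ℝ) (π : S → ℝ),
    IsIrreducibleReversible P π →
    ∀ (Ω : Type) [MeasurableSpace Ω] (μ : MeasureTheory.Measure Ω)
      [MeasureTheory.IsProbabilityMeasure μ] (X : ℕ → Ω → S), IsMarkovChain π P μ X →
    ∀ (φ : S → E) (n : ℕ),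
      ∫⁻ ω, (Finset.range (n + 1)).sup (fun m => edist (φ (X 0 ω)) (φ (X m ω)) ^ p) ∂μ ≤
        (C : ℝ≥0∞) ^ p * n * ∫⁻ ω, edist (φ (X 0 ω)) (φ (X 1 ω)) ^ p ∂μ

/-- `E` has maximal Markov type `p`. -/
def HasMaximalMarkovType (E : Type*) [PseudoEMetricSpace E] (p : ℝ) : Prop :=
  ∃ C : ℝ≥0, HasMaximalMarkovTypeWith E p C

/-- The maximal Markov type `p` constant of `E`, written `M_p^*(E)`: the infimum of all admissible
constants (`∞` if there are none). -/
noncomputable def maximalMarkovTypeConst (E : Type*) [PseudoEMetricSpace E] (p : ℝ) : ℝ≥0∞ :=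
  ⨅ (C : ℝ≥0) (_ : HasMaximalMarkovTypeWith E p C), (C : ℝ≥0∞)

namespace Graph

variable {α β : Type*}

/-! ### Planar graphs -/

/-- A drawing without crossings of a multigraph in the plane: vertices are distinct points, edges
are arcs (closed curves, for loops) joining their ends, every edge is simple, and the interior of
an edge meets neither a vertex nor the interior of another edge. -/
structure PlaneDrawing (G : Graph α β) where
  point : V(G) → ℂ
  arc : E(G) → C(unitInterval, ℂ)
  point_injective : Function.Injective point
  arc_ends : ∀ e : E(G), ∃ x y : V(G), G.IsLink e x y ∧ arc e 0 = point x ∧ arc e 1 = point y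
  arc_injOn : ∀ e, Set.InjOn (arc e) (Set.Ioo 0 1)
  arc_ne_point : ∀ e, ∀ t ∈ Set.Ioo (0 : unitInterval) 1, ∀ x, arc e t ≠ point x
  arc_disjoint : ∀ e f, e ≠ f → Disjoint (arc e '' Set.Ioo 0 1) (arc f '' Set.Ioo 0 1)

/-- A graph is planar if it can be drawn in the plane without crossings. -/
def IsPlanar (G : Graph α β) : Prop := Nonempty G.PlaneDrawing

/-! ### The weighted graph distance -/

/-- `P 0, P 1, …, P n` is a path of length `n` from `v` to `w`: consecutive vertices are equal or
joined by an edge. -/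
structure IsLazyPath (G : Graph α β) (v w : V(G)) (n : ℕ) (P : ℕ → V(G)) : Prop where
  start : P 0 = v
  finish : P n = w
  step : ∀ i < n, P i = P (i + 1) ∨ G.Adj (P i) (P (i + 1))

/-- The weighted length `∑_{i=1}^n (ω(P(i)) + ω(P(i-1))) / 2` of a path of length `n`. -/
noncomputable def weightedLength {G : Graph α β} (ω : V(G) → ℝ≥0) (n : ℕ) (P : ℕ → V(G)) : ℝ≥0 :=
  ∑ i ∈ Finset.range n, (ω (P (i + 1)) + ω (P i)) / 2

/-- The weighted graph distance: the infimum of the weighted lengths of all finite paths from `v`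
to `w` (`∞` if there are none). -/
noncomputable def weightedDist (G : Graph α β) (ω : V(G) → ℝ≥0) (v w : V(G)) : ℝ≥0∞ :=
  ⨅ (n : ℕ) (P : ℕ → V(G)) (_ : G.IsLazyPath v w n P), (weightedLength ω n P : ℝ≥0∞)

theorem weightedDist_self (G : Graph α β) (ω : V(G) → ℝ≥0) (v : V(G)) :
    G.weightedDist ω v v = 0 := by
  refine le_antisymm ?_ zero_le
  refine iInf_le_of_le 0 (iInf_le_of_le (fun _ => v) (iInf_le_of_le ⟨rfl, rfl, by simp⟩ ?_))
  simp [weightedLength]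

theorem weightedDist_comm_le (G : Graph α β) (ω : V(G) → ℝ≥0) (v w : V(G)) :
    G.weightedDist ω v w ≤ G.weightedDist ω w v := by
  refine le_iInf fun n => le_iInf fun P => le_iInf fun hP => ?_
  refine iInf_le_of_le n (iInf_le_of_le (fun i => P (n - i)) (iInf_le_of_le ⟨?_, ?_, ?_⟩ ?_))
  · simpa using hP.finish
  · simpa using hP.start
  · intro i hi
    have h := hP.step (n - (i + 1)) (by omega)
    rw [show n - (i + 1) + 1 = n - i by omega] at h
    exact h.imp Eq.symm Graph.Adj.symm
  · refine le_of_eq (congrArg _ ?_)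
    unfold weightedLength
    rw [← Finset.sum_range_reflect]
    refine Finset.sum_congr rfl fun i hi => ?_
    have hi := Finset.mem_range.1 hi
    beta_reduce
    rw [show n - (n - 1 - i + 1) = i by omega, show n - (n - 1 - i) = i + 1 by omega, add_comm]

theorem weightedDist_triangle (G : Graph α β) (ω : V(G) → ℝ≥0) (u v w : V(G)) :
    G.weightedDist ω u w ≤ G.weightedDist ω u v + G.weightedDist ω v w := by
  unfold weightedDist
  simp only [ENNReal.iInf_add, ENNReal.add_iInf]
  refine le_iInf fun m => le_iInf fun Q => le_iInf fun hQ => ?_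
  refine le_iInf fun n => le_iInf fun P => le_iInf fun hP => ?_
  set R : ℕ → V(G) := fun i => if i ≤ n then P i else Q (i - n) with hR
  have hRP : ∀ i ≤ n, R i = P i := fun i hi => by simp [hR, hi]
  have hRQ : ∀ i, R (n + i) = Q i := fun i => by
    rcases Nat.eq_zero_or_pos i with rfl | hi
    · simp [hR, hP.finish, hQ.start]
    · have : ¬ n + i ≤ n := by omega
      simp [hR, this]
  refine iInf_le_of_le (n + m) (iInf_le_of_le R (iInf_le_of_le ⟨?_, ?_, ?_⟩ ?_))
  · rw [hRP 0 (Nat.zero_le _), hP.start]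
  · rw [hRQ, hQ.finish]
  · intro i hi
    by_cases h : i < n
    · rw [hRP i h.le, hRP (i + 1) h]
      exact hP.step i h
    · obtain ⟨j, rfl⟩ := Nat.exists_eq_add_of_le (not_lt.1 h)
      rw [hRQ, add_assoc, hRQ]
      exact hQ.step j (by omega)
  · rw [← ENNReal.coe_add]
    refine le_of_eq (congrArg _ ?_)
    unfold weightedLength
    rw [Finset.sum_range_add]
    congr 1
    · refine Finset.sum_congr rfl fun i hi => ?_
      have hi := Finset.mem_range.1 hi
      rw [hRP i hi.le, hRP (i + 1) hi]
    · refine Finset.sum_congr rfl fun i _ => ?_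
      rw [hRQ, add_assoc, hRQ]

/-- The vertex set of the vertex-weighted graph `(G, ω)`, as a space with the weighted graph
distance. -/
def WeightedSpace (G : Graph α β) (_ω : V(G) → ℝ≥0) : Type _ := V(G)

noncomputable instance (G : Graph α β) (ω : V(G) → ℝ≥0) :
    PseudoEMetricSpace (G.WeightedSpace ω) where
  edist := G.weightedDist ω
  edist_self := G.weightedDist_self ω
  edist_comm v w := le_antisymm (G.weightedDist_comm_le ω v w) (G.weightedDist_comm_le ω w v)
  edist_triangle := G.weightedDist_triangle ω

end Graph

/-!
Markov type of weighted planar graphs, following the threshold embeddings of Ding, Lee and Peres.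

The square of a displacement is a sum over dyadic scales `τ`, so one has to bound, at each scale,
the probability that a stationary reversible chain moves by `τ`, with a bound whose sum over `τ` is
controlled by the mean square of one step.

*From functions to chains.* If `f` is `1`-Lipschitz for the distance truncated at `τ / L`, then
`f (X k) - f (X 0)` is, up to two boundary terms, half the difference of a martingale for the chain
and a martingale for its time reversal. A fourth moment estimate for the martingale, stopped when
its bracket exceeds `τ ^ 2` or the martingale itself reaches the scale
(`IsReversibleChain.maximal_inequality`), bounds the probability of an oscillation of order `τ` by
the mean of `min 1 ((Q / τ ^ 2) ^ 2)`, where the bracket `Q` does not depend on `f` or on the scale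
(`IsReversibleChain.oscillation`). Such bounds can be summed over the scales, which gives maximal
Markov type `2` for every space with threshold maps (`IsReversibleChain.displacement_sq_le`):
random functions of the above kind that separate any two points at distance at least `τ` with
probability bounded below.

*Threshold maps.* They are truncated distances to random unions of the pieces of a random
partition into pieces of diameter less than `τ` such that each ball of radius `τ / L` is contained
in a piece with probability at least one half (`hasThresholdMaps_of_partitions`). In a graph
without `K_{3,3}` minor such partitions are obtained, following Klein, Plotkin and Rao, by chopping
three times into annuli of random offset around arbitrary roots
(`LengthGraph.exists_padded_partitions`). If a piece were too large, its three far away points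
could be joined to the balls around each of the three roots by shortest paths, giving a `K_{3,3}`
minor (`LengthGraph.PartialMinor.extend`). Lengths are rounded to integers, so that distances to a
root are attained, and edges longer than the padding are dropped.

*Planarity.* A `K_{3,3}` minor in a plane drawing yields nine paths joining three points to three
points such that paths without common end are disjoint. For two disjoint paths `γ` and `δ` the
function `γ s - δ t` has a continuous logarithm on the square, which relates the winding of `γ`
around the ends of `δ` to that of `δ` around the ends of `γ`; the sum of these relations over all
pairs of disjoint edges is contradictory modulo `4` (`not_disjoint_K33_paths`). This replaces the
Jordan curve theorem.
-/

/-! ### Variation of the logarithm along a path -/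

/-- A continuous nowhere vanishing function on a retract of a normed space has a continuous
logarithm, and it is unique once its value at one point is prescribed. -/
theorem existsUnique_continuous_log {A E : Type*} [TopologicalSpace A] [NormedAddCommGroup E]
    [NormedSpace ℝ E] (i : C(A, E)) (r : C(E, A)) (hr : ∀ a, r (i a) = a)
    (F : C(A, ℂ)) (hF : ∀ a, F a ≠ 0) :
    (∃ g : C(A, ℂ), ∀ a, Complex.exp (g a) = F a) ∧
      ∀ g g' : C(A, ℂ), (∀ a, Complex.exp (g a) = F a) → (∀ a, Complex.exp (g' a) = F a) →
        ∀ a, g a = g' a → g = g' := by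
  have H := fun (e : E) (z : ℂ) (hz : Complex.exp z = F.comp r e) =>
    Complex.isCoveringMapOn_exp.existsUnique_continuousMap_lifts (F.comp r)
      (a₀ := e) (e₀ := z) hz (fun a => hF (r a))
  constructor
  · obtain ⟨g, ⟨-, hg⟩, -⟩ := H 0 _ (Complex.exp_log (hF (r 0)))
    refine ⟨g.comp i, fun a => ?_⟩
    have := congrFun hg (i a)
    simpa [hr] using this
  · intro g g' hg hg' a haa
    obtain ⟨_, -, hu⟩ := H (i a) (g a) (by simp [hr, hg])
    have e1 := hu (g.comp r) ⟨by simp [hr], by ext t; simp [hg]⟩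
    have e2 := hu (g'.comp r) ⟨by simp [hr, haa], by ext t; simp [hg']⟩
    ext x
    have := DFunLike.congr_fun (e1.trans e2.symm) (i x)
    simpa [hr] using this

/-- Continuous logarithms on the unit interval, which is a retract of the real line. -/
theorem existsUnique_continuous_log_unitInterval (F : C(unitInterval, ℂ)) (hF : ∀ a, F a ≠ 0) :
    (∃ g : C(unitInterval, ℂ), ∀ a, Complex.exp (g a) = F a) ∧
      ∀ g g' : C(unitInterval, ℂ), (∀ a, Complex.exp (g a) = F a) →
        (∀ a, Complex.exp (g' a) = F a) → ∀ a, g a = g' a → g = g' :=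
  existsUnique_continuous_log (E := ℝ) ⟨fun t => t.1, by fun_prop⟩
    ⟨Set.projIcc 0 1 zero_le_one, continuous_projIcc⟩ (fun a => Set.projIcc_val zero_le_one a) F hF

/-- Continuous logarithms on the unit square, which is a retract of the plane. -/
theorem exists_continuous_log_square (F : C(unitInterval × unitInterval, ℂ))
    (hF : ∀ a, F a ≠ 0) :
    ∃ g : C(unitInterval × unitInterval, ℂ), ∀ a, Complex.exp (g a) = F a :=
  (existsUnique_continuous_log (E := ℝ × ℝ) ⟨fun t => (t.1.1, t.2.1), by fun_prop⟩
    ⟨fun x => (Set.projIcc 0 1 zero_le_one x.1, Set.projIcc 0 1 zero_le_one x.2),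
      (continuous_projIcc.comp continuous_fst).prodMk (continuous_projIcc.comp continuous_snd)⟩
    (fun a => Prod.ext (Set.projIcc_val zero_le_one a.1) (Set.projIcc_val zero_le_one a.2)) F hF).1

/-- Two continuous logarithms of the same path have the same increment. -/
theorem log_increment_unique (g g' : C(unitInterval, ℂ))
    (h : ∀ t, Complex.exp (g t) = Complex.exp (g' t)) : g 1 - g 0 = g' 1 - g' 0 := by
  have h0 : Complex.exp (g 0 - g' 0) = 1 := by
    rw [Complex.exp_sub, h 0, div_self (Complex.exp_ne_zero _)]
  have := DFunLike.congr_fun ((existsUnique_continuous_log_unitInterval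
    ⟨fun t => Complex.exp (g t), by fun_prop⟩ (fun a => Complex.exp_ne_zero _)).2
    g ⟨fun t => g' t + (g 0 - g' 0), by fun_prop⟩ (fun _ => rfl)
    (fun t => by simp [Complex.exp_add, h0, h]) 0 (by simp)) 1
  simp only [ContinuousMap.coe_mk] at this
  rw [this]; ring

open Classical in
/-- The increment along the path `γ` of a continuous branch of `log (γ - v)`; it is `0` by
convention if there is no such branch, that is, if `γ` passes through `v`. -/
noncomputable def logVariation (γ : C(unitInterval, ℂ)) (v : ℂ) : ℂ :=
  if h : ∃ g : C(unitInterval, ℂ), ∀ t, Complex.exp (g t) = γ t - v then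
    h.choose 1 - h.choose 0 else 0

theorem logVariation_eq {γ : C(unitInterval, ℂ)} {v : ℂ} (g : C(unitInterval, ℂ))
    (hg : ∀ t, Complex.exp (g t) = γ t - v) : logVariation γ v = g 1 - g 0 := by
  have h : ∃ g : C(unitInterval, ℂ), ∀ t, Complex.exp (g t) = γ t - v := ⟨g, hg⟩
  rw [logVariation, dif_pos h]
  exact log_increment_unique _ _ fun t => by rw [hg, h.choose_spec]

theorem logVariation_eq_log {γ : C(unitInterval, ℂ)} {v : ℂ} (h : ∀ t, γ t ≠ v) :
    ∃ k : ℤ, logVariation γ v =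
      Complex.log (γ 1 - v) - Complex.log (γ 0 - v) + k * (2 * Real.pi * Complex.I) := by
  obtain ⟨g, hg⟩ := (existsUnique_continuous_log_unitInterval ⟨fun t => γ t - v, by fun_prop⟩
    (fun t => sub_ne_zero.2 (h t))).1
  rw [logVariation_eq g hg]
  have key : ∀ t, ∃ k : ℤ, g t = Complex.log (γ t - v) + k * (2 * Real.pi * Complex.I) :=
    fun t => Complex.exp_eq_exp_iff_exists_int.1 (by
      rw [hg, Complex.exp_log (sub_ne_zero.2 (h t))]; rfl)
  obtain ⟨k₁, h₁⟩ := key 1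
  obtain ⟨k₀, h₀⟩ := key 0
  refine ⟨k₁ - k₀, ?_⟩
  rw [h₁, h₀]; push_cast; ring

/-- For two disjoint paths, a continuous logarithm of `γ s - δ t` on the square computes the
mixed difference of the variations in two ways. -/
theorem logVariation_exchange {γ δ : C(unitInterval, ℂ)} (h : ∀ s t, γ s ≠ δ t) :
    logVariation γ (δ 1) - logVariation γ (δ 0) =
      logVariation δ (γ 1) - logVariation δ (γ 0) := by
  obtain ⟨g, hg⟩ := exists_continuous_log_square ⟨fun x => γ x.1 - δ x.2, by fun_prop⟩
    (fun x => sub_ne_zero.2 (h x.1 x.2))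
  have hγ : ∀ t, logVariation γ (δ t) = g (1, t) - g (0, t) := fun t =>
    logVariation_eq ⟨fun s => g (s, t), by fun_prop⟩ fun s => hg (s, t)
  have hδ : ∀ s, logVariation δ (γ s) = g (s, 1) - g (s, 0) := fun s => by
    rw [logVariation_eq (⟨fun t => g (s, t) + Real.pi * Complex.I, by fun_prop⟩ :
      C(unitInterval, ℂ)) fun t => ?_]
    · simp
    · have := hg (s, t)
      simp only [ContinuousMap.coe_mk] at this ⊢
      rw [Complex.exp_add, this, Complex.exp_pi_mul_I]; ring
  rw [hγ, hγ, hδ, hδ]; ring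

theorem log_sub_log_neg {z : ℂ} (hz : z ≠ 0) :
    ∃ m : ℤ, Complex.log z - Complex.log (-z) = (2 * m + 1) * (Real.pi * Complex.I) := by
  have : Complex.exp (Complex.log z) = Complex.exp (Complex.log (-z) + Real.pi * Complex.I) := by
    rw [Complex.exp_add, Complex.exp_log hz, Complex.exp_log (neg_ne_zero.2 hz),
      Complex.exp_pi_mul_I]; ring
  obtain ⟨m, hm⟩ := Complex.exp_eq_exp_iff_exists_int.1 this
  exact ⟨m, by rw [hm]; ring⟩

/-! ### Nonplanarity of the complete bipartite graph on three and three vertices -/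

/-- The complete bipartite graph `K_{3,3}` cannot be drawn in the plane, even if edges with a
common end are allowed to intersect: the sum of the exchange identities over all pairs of edges
without common end fails modulo `4` (in units of `π * I`). -/
theorem not_disjoint_K33_paths (p q : Fin 3 → ℂ) (γ : Fin 3 → Fin 3 → C(unitInterval, ℂ))
    (h0 : ∀ i l, γ i l 0 = p i) (h1 : ∀ i l, γ i l 1 = q l) :
    ¬ ∀ i j l m, i ≠ j → l ≠ m → ∀ s t, γ i l s ≠ γ j m t := by
  intro hd
  have hpi : (Real.pi : ℂ) * Complex.I ≠ 0 := by simp [Real.pi_ne_zero]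
  have ex : ∀ i : Fin 3, ∃ j, i ≠ j := by decide
  have hq : ∀ i l m, l ≠ m → ∀ t, γ i l t ≠ q m := fun i l m hlm t => by
    obtain ⟨j, hj⟩ := ex i
    rw [← h1 j m]; exact hd i j l m hj hlm t 1
  have hp : ∀ i l j, i ≠ j → ∀ t, γ i l t ≠ p j := fun i l j hij t => by
    obtain ⟨m, hm⟩ := ex l
    rw [← h0 j m]; exact hd i j l m hij hm t 0
  have hK : ∀ i l m, ∃ k : ℤ, l ≠ m → logVariation (γ i l) (q m) =
      Complex.log (q l - q m) - Complex.log (p i - q m) + k * (2 * Real.pi * Complex.I) := by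
    intro i l m
    by_cases hlm : l = m
    · exact ⟨0, fun h => absurd hlm h⟩
    · obtain ⟨k, hk⟩ := logVariation_eq_log (hq i l m hlm)
      rw [h0, h1] at hk
      exact ⟨k, fun _ => hk⟩
  have hJ : ∀ i l j, ∃ k : ℤ, i ≠ j → logVariation (γ i l) (p j) =
      Complex.log (q l - p j) - Complex.log (p i - p j) + k * (2 * Real.pi * Complex.I) := by
    intro i l j
    by_cases hij : i = j
    · exact ⟨0, fun h => absurd hij h⟩
    · obtain ⟨k, hk⟩ := logVariation_eq_log (hp i l j hij)
      rw [h0, h1] at hk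
      exact ⟨k, fun _ => hk⟩
  have hσ : ∀ x y : ℂ, ∃ m : ℤ, x ≠ y →
      Complex.log (x - y) - Complex.log (y - x) = (2 * m + 1) * (Real.pi * Complex.I) := by
    intro x y
    by_cases hxy : x = y
    · exact ⟨0, fun h => absurd hxy h⟩
    · obtain ⟨m, hm⟩ := log_sub_log_neg (sub_ne_zero.2 hxy)
      rw [neg_sub] at hm
      exact ⟨m, fun _ => hm⟩
  choose K hK using hK
  choose J hJ using hJ
  choose σ hσ using hσ
  have hpp : ∀ i j, i ≠ j → p i ≠ p j := fun i j hij => by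
    have := hp i 0 j hij 0; rwa [h0] at this
  have hqq : ∀ l m, l ≠ m → q l ≠ q m := fun l m hlm => by
    have := hq 0 l m hlm 1; rwa [h1] at this
  have hpq : ∀ i l, p i ≠ q l := fun i l => by
    obtain ⟨m, hm⟩ := ex l
    have := hq i m l hm.symm 0; rwa [h0] at this
  have eqn : ∀ i j l m, i ≠ j → l ≠ m →
      (2 * σ (q l) (q m) + 1) + (2 * σ (p i) (p j) + 1) + (2 * σ (p j) (q l) + 1)
        - (2 * σ (p i) (q m) + 1) + 2 * (K i l m - J i l j - K j m l + J j m i) = 0 := by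
    intro i j l m hij hlm
    have e := logVariation_exchange (hd i j l m hij hlm)
    rw [h0, h1, h0, h1, hK i l m hlm, hJ i l j hij, hK j m l hlm.symm, hJ j m i hij.symm] at e
    have e1 := hσ _ _ (hqq l m hlm)
    have e2 := hσ _ _ (hpp i j hij)
    have e3 := hσ _ _ (hpq j l)
    have e4 := hσ _ _ (hpq i m)
    have : ((((2 * σ (q l) (q m) + 1) + (2 * σ (p i) (p j) + 1) + (2 * σ (p j) (q l) + 1)
        - (2 * σ (p i) (q m) + 1) + 2 * (K i l m - J i l j - K j m l + J j m i) : ℤ)) : ℂ)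
        * (Real.pi * Complex.I) = 0 := by
      push_cast
      linear_combination e - e1 - e2 - e3 + e4
    exact_mod_cast (mul_eq_zero.1 this).resolve_right hpi
  have anti : ∀ l m, l ≠ m → (2 * σ (q l) (q m) + 1) + (2 * σ (q m) (q l) + 1) = 0 := by
    intro l m hlm
    have e1 := hσ _ _ (hqq l m hlm)
    have e2 := hσ _ _ (hqq m l hlm.symm)
    have : ((((2 * σ (q l) (q m) + 1) + (2 * σ (q m) (q l) + 1) : ℤ)) : ℂ)
        * (Real.pi * Complex.I) = 0 := by
      push_cast
      linear_combination - e1 - e2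
    exact_mod_cast (mul_eq_zero.1 this).resolve_right hpi
  have a01 := anti 0 1 (by decide)
  have a02 := anti 0 2 (by decide)
  have a12 := anti 1 2 (by decide)
  have E : ∀ i j, i ≠ j → _ := fun i j hij =>
    And.intro (eqn i j 0 1 hij (by decide)) <| And.intro (eqn i j 1 0 hij (by decide)) <|
    And.intro (eqn i j 0 2 hij (by decide)) <| And.intro (eqn i j 2 0 hij (by decide)) <|
    And.intro (eqn i j 1 2 hij (by decide)) (eqn i j 2 1 hij (by decide))
  have E01 := E 0 1 (by decide)
  have E02 := E 0 2 (by decide)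
  have E12 := E 1 2 (by decide)
  omega

/-! ### Planar graphs have no `K_{3,3}` minor -/

/-- The vertices `x` and `y` are joined by a path of the relation `r` all of whose vertices
after the first lie in `H`. -/
def ConnectedWithin {V : Type*} (r : V → V → Prop) (H : Set V) (x y : V) : Prop :=
  Relation.ReflTransGen (fun a b => r a b ∧ b ∈ H) x y

/-- `A 0, A 1, A 2` and `B 0, B 1, B 2` are the branch sets of a `K_{3,3}` minor of the graph with
adjacency relation `r`: they are nonempty, connected and pairwise disjoint, and there is an edge
between each `A i` and each `B l`. -/
structure IsK33Minor {V : Type*} (r : V → V → Prop) (A B : Fin 3 → Set V) : Prop where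
  nonempty_left : ∀ i, (A i).Nonempty
  nonempty_right : ∀ l, (B l).Nonempty
  connected_left : ∀ i, ∀ x ∈ A i, ∀ y ∈ A i, ConnectedWithin r (A i) x y
  connected_right : ∀ l, ∀ x ∈ B l, ∀ y ∈ B l, ConnectedWithin r (B l) x y
  disjoint_left : ∀ i j, i ≠ j → Disjoint (A i) (A j)
  disjoint_right : ∀ l m, l ≠ m → Disjoint (B l) (B m)
  disjoint_left_right : ∀ i l, Disjoint (A i) (B l)
  adj : ∀ i l, ∃ x ∈ A i, ∃ y ∈ B l, r x y

namespace Graph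

variable {α β : Type*} {G : Graph α β}

/-- The part of a plane drawing carried by a set `X` of vertices: the points of `X`, and the arcs
all of whose ends belong to `X`. -/
def PlaneDrawing.region (D : G.PlaneDrawing) (X : Set V(G)) : Set ℂ :=
  D.point '' X ∪ {z | ∃ e : E(G), (∀ x y : V(G), G.IsLink e x y → x ∈ X ∧ y ∈ X) ∧
    ∃ t, D.arc e t = z}

theorem PlaneDrawing.mem_region (D : G.PlaneDrawing) {X : Set V(G)} {z : ℂ}
    (hz : z ∈ D.region X) : (∃ x ∈ X, D.point x = z) ∨
      ∃ e : E(G), (∀ x y : V(G), G.IsLink e x y → x ∈ X ∧ y ∈ X) ∧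
        ∃ t ∈ Set.Ioo (0 : unitInterval) 1, D.arc e t = z := by
  rcases hz with ⟨x, hx, rfl⟩ | ⟨e, he, t, rfl⟩
  · exact Or.inl ⟨x, hx, rfl⟩
  · obtain ⟨x, y, hl, h0, h1⟩ := D.arc_ends e
    rcases eq_or_lt_of_le (unitInterval.nonneg' (t := t)) with rfl | h0'
    · exact Or.inl ⟨x, (he x y hl).1, h0.symm⟩
    rcases eq_or_lt_of_le (unitInterval.le_one' (t := t)) with rfl | h1'
    · exact Or.inl ⟨y, (he x y hl).2, h1.symm⟩
    exact Or.inr ⟨e, he, t, ⟨h0', h1'⟩, rfl⟩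

theorem PlaneDrawing.disjoint_region (D : G.PlaneDrawing) {X Y : Set V(G)} (h : Disjoint X Y) :
    Disjoint (D.region X) (D.region Y) := by
  rw [Set.disjoint_left]
  intro z hX hY
  rcases D.mem_region hX with ⟨x, hx, hxz⟩ | ⟨e, he, t, ht, hez⟩ <;>
    rcases D.mem_region hY with ⟨y, hy, hyz⟩ | ⟨f, hf, s, hs, hfz⟩
  · exact Set.disjoint_left.1 h hx (D.point_injective (hxz.trans hyz.symm) ▸ hy)
  · exact D.arc_ne_point f s hs x (hfz.trans hxz.symm)
  · exact D.arc_ne_point e t ht y (hez.trans hyz.symm)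
  · obtain ⟨x, y, hl, -⟩ := D.arc_ends e
    by_cases hef : e = f
    · subst hef
      exact Set.disjoint_left.1 h (he x y hl).1 (hf x y hl).1
    · exact Set.disjoint_left.1 (D.arc_disjoint e f hef) ⟨t, ht, hez⟩ ⟨s, hs, hfz⟩

theorem PlaneDrawing.joinedIn_of_adj (D : G.PlaneDrawing) {X : Set V(G)} {x y : V(G)}
    (hx : x ∈ X) (hy : y ∈ X) (h : G.Adj x y) : JoinedIn (D.region X) (D.point x) (D.point y) := by
  obtain ⟨e, he⟩ := h
  have hX : ∀ a b : V(G), G.IsLink e a b → a ∈ X ∧ b ∈ X := by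
    intro a b hab
    rcases he.eq_and_eq_or_eq_and_eq hab with ⟨h1, h2⟩ | ⟨h1, h2⟩
    · exact ⟨Subtype.ext h1 ▸ hx, Subtype.ext h2 ▸ hy⟩
    · exact ⟨Subtype.ext h2 ▸ hy, Subtype.ext h1 ▸ hx⟩
  obtain ⟨a, b, hl, h0, h1⟩ := D.arc_ends ⟨e, he.edge_mem⟩
  have hJ : JoinedIn (D.region X) (D.point a) (D.point b) :=
    ⟨⟨D.arc ⟨e, he.edge_mem⟩, h0, h1⟩, fun t => Or.inr ⟨⟨e, he.edge_mem⟩, hX, t, rfl⟩⟩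
  rcases he.eq_and_eq_or_eq_and_eq hl with ⟨h1, h2⟩ | ⟨h1, h2⟩
  · rwa [← Subtype.ext h1, ← Subtype.ext h2] at hJ
  · rw [← Subtype.ext h1, ← Subtype.ext h2] at hJ
    exact hJ.symm

theorem PlaneDrawing.joinedIn (D : G.PlaneDrawing) {X Y : Set V(G)} (hXY : X ⊆ Y) {x y : V(G)}
    (hx : x ∈ X) (h : ConnectedWithin (fun a b : V(G) => G.Adj a b) X x y) :
    y ∈ X ∧ JoinedIn (D.region Y) (D.point x) (D.point y) := by
  induction h with
  | refl => exact ⟨hx, JoinedIn.refl (Or.inl ⟨x, hXY hx, rfl⟩)⟩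
  | tail _ hbc ih =>
    exact ⟨hbc.2, ih.2.trans (D.joinedIn_of_adj (hXY ih.1) (hXY hbc.2) hbc.1)⟩

theorem IsPlanar.not_isK33Minor (hG : G.IsPlanar) (A B : Fin 3 → Set V(G)) :
    ¬ IsK33Minor (fun x y : V(G) => G.Adj x y) A B := by
  obtain ⟨D⟩ := hG
  intro h
  choose a ha using h.nonempty_left
  choose b hb using h.nonempty_right
  have key : ∀ i l, JoinedIn (D.region (A i ∪ B l)) (D.point (a i)) (D.point (b l)) := by
    intro i l
    obtain ⟨x, hx, y, hy, hxy⟩ := h.adj i l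
    exact ((D.joinedIn Set.subset_union_left (ha i) (h.connected_left i _ (ha i) _ hx)).2.trans
      (D.joinedIn_of_adj (Or.inl hx) (Or.inr hy) hxy)).trans
      (D.joinedIn Set.subset_union_right hy (h.connected_right l _ hy _ (hb l))).2
  refine not_disjoint_K33_paths (fun i => D.point (a i)) (fun l => D.point (b l))
    (fun i l => (key i l).somePath.toContinuousMap) (fun i l => (key i l).somePath.source)
    (fun i l => (key i l).somePath.target) fun i j l m hij hlm s t hst => ?_
  have hdisj : Disjoint (A i ∪ B l) (A j ∪ B m) := by
    simp only [Set.disjoint_union_left, Set.disjoint_union_right]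
    exact ⟨⟨h.disjoint_left i j hij, (h.disjoint_left_right j l).symm⟩,
      h.disjoint_left_right i m, h.disjoint_right l m hlm⟩
  refine Set.disjoint_left.1 (D.disjoint_region hdisj) ((key i l).somePath_mem s) ?_
  have : (key i l).somePath s = (key j m).somePath t := hst
  rw [this]
  exact (key j m).somePath_mem t

end Graph

/-! ### Walks and levels in graphs with integral edge lengths -/

/-- A graph on the vertex set `V` whose edges have lengths in `{1, …, W}`. -/
structure LengthGraph (V : Type*) (W : ℕ) where
  Adj : V → V → Prop
  symm : ∀ {x y}, Adj x y → Adj y x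
  len : V → V → ℕ
  len_comm : ∀ x y, len x y = len y x
  one_le_len : ∀ {x y}, Adj x y → 1 ≤ len x y
  len_le : ∀ {x y}, Adj x y → len x y ≤ W

namespace LengthGraph

variable {V : Type*} {W : ℕ} (G : LengthGraph V W)

/-- `G.Walk H x n y`: there is a walk of total length `n` from `x` to `y` all of whose vertices
lie in `H`. -/
inductive Walk (H : Set V) (x : V) : ℕ → V → Prop
  | nil : x ∈ H → Walk H x 0 x
  | snoc {n : ℕ} {y z : V} : Walk H x n y → G.Adj y z → z ∈ H → Walk H x (n + G.len y z) z

variable {G} {H H' : Set V} {x y z : V} {m n : ℕ}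

theorem Walk.right_mem (h : G.Walk H x n y) : y ∈ H := by
  cases h <;> assumption

theorem Walk.mono (h : G.Walk H x n y) (hH : H ⊆ H') : G.Walk H' x n y := by
  induction h with
  | nil h => exact .nil (hH h)
  | snoc _ ha hz ih => exact .snoc ih ha (hH hz)

theorem Walk.trans (h : G.Walk H x m y) (h' : G.Walk H y n z) : G.Walk H x (m + n) z := by
  induction h' with
  | nil _ => exact h
  | snoc _ ha hz ih => rw [← add_assoc]; exact .snoc ih ha hz

theorem Walk.single (hx : x ∈ H) (hy : y ∈ H) (h : G.Adj x y) : G.Walk H x (G.len x y) y := by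
  simpa using Walk.snoc (Walk.nil hx) h hy

theorem Walk.symm (h : G.Walk H x n y) : G.Walk H y n x := by
  induction h with
  | nil h => exact .nil h
  | snoc hw ha hz ih =>
    rw [add_comm, G.len_comm]
    exact (Walk.single hz hw.right_mem (G.symm ha)).trans ih

theorem Walk.connectedWithin (h : G.Walk H x n y) : ConnectedWithin G.Adj H x y := by
  induction h with
  | nil _ => exact .refl
  | snoc _ ha hz ih => exact .tail ih ⟨ha, hz⟩

theorem exists_walk (hx : x ∈ H) (h : ConnectedWithin G.Adj H x y) : ∃ n, G.Walk H x n y := by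
  induction h with
  | refl => exact ⟨0, .nil hx⟩
  | tail _ hbc ih =>
    obtain ⟨n, hn⟩ := ih
    exact ⟨_, .snoc hn hbc.1 hbc.2⟩

variable (G)

/-- A set of vertices is connected if any two of its vertices are joined by a walk inside it. -/
def IsConnected (H : Set V) : Prop := ∀ x ∈ H, ∀ y ∈ H, ConnectedWithin G.Adj H x y

variable {G}

theorem connectedWithin_symm (hx : x ∈ H) (h : ConnectedWithin G.Adj H x y) :
    ConnectedWithin G.Adj H y x := by
  obtain ⟨n, hn⟩ := exists_walk hx h
  exact hn.symm.connectedWithin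

theorem connectedWithin_mono (hH : H ⊆ H') (h : ConnectedWithin G.Adj H x y) :
    ConnectedWithin G.Adj H' x y :=
  Relation.ReflTransGen.mono (fun a b (h : G.Adj a b ∧ b ∈ H) => ⟨h.1, hH h.2⟩) _ _ h

theorem isConnected_of_center (hx : x ∈ H) (h : ∀ y ∈ H, ConnectedWithin G.Adj H x y) :
    G.IsConnected H := fun y hy z hz => (connectedWithin_symm hx (h y hy)).trans (h z hz)

variable (G)

/-- The function `lev` behaves on `H` like the distance inside `H` to the vertex `root`: it changes
by at most the length of an edge, and every vertex other than the root has a neighbour on a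
shortest walk to the root. -/
structure IsLevel (H : Set V) (root : V) (lev : V → ℕ) : Prop where
  root_mem : root ∈ H
  lev_root : lev root = 0
  lev_le : ∀ x ∈ H, ∀ y ∈ H, G.Adj x y → lev y ≤ lev x + G.len x y
  parent : ∀ x ∈ H, x ≠ root → ∃ y ∈ H, G.Adj x y ∧ lev x = lev y + G.len x y

variable {G}

theorem IsConnected.exists_isLevel (hH : G.IsConnected H) {root : V} (hr : root ∈ H) :
    ∃ lev, G.IsLevel H root lev := by
  set lev : V → ℕ := fun x => sInf {n | G.Walk H root n x} with hlev
  have hle : ∀ {x n}, G.Walk H root n x → lev x ≤ n := fun h => Nat.sInf_le h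
  have hmem : ∀ x ∈ H, G.Walk H root (lev x) x := fun x hx =>
    Nat.sInf_mem (s := {n | G.Walk H root n x}) (exists_walk hr (hH root hr x hx))
  refine ⟨lev, hr, Nat.le_zero.1 (hle (.nil hr)), fun x hx y hy h => ?_, fun x hx hne => ?_⟩
  · exact hle (.snoc (hmem x hx) h hy)
  · have hw := hmem x hx
    generalize hk : lev x = k at hw
    cases hw with
    | nil _ => exact absurd rfl hne
    | @snoc n y _ hw ha _ =>
      refine ⟨y, hw.right_mem, G.symm ha, ?_⟩
      have h1 := hle hw
      have h2 := hle (.snoc (hmem y hw.right_mem) ha hx)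
      rw [G.len_comm x y]
      omega

section Level

variable {root : V} {lev : V → ℕ}

theorem IsLevel.lev_le_of_walk (hL : G.IsLevel H root lev) (h : G.Walk H x n y) :
    lev y ≤ lev x + n := by
  induction h with
  | nil _ => simp
  | snoc hw ha hz ih =>
    have := hL.lev_le _ hw.right_mem _ hz ha
    omega

theorem IsLevel.walk_root (hL : G.IsLevel H root lev) (c : ℕ) (y : V) (hy : y ∈ H)
    (hc : lev y ≤ c) :
    G.Walk {z ∈ H | lev z ≤ c} y (lev y) root := by
  induction hN : lev y using Nat.strong_induction_on generalizing y with
  | _ N ih =>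
    by_cases hr : y = root
    · subst hr
      rw [← hN, hL.lev_root]
      exact .nil ⟨hy, hc⟩
    · obtain ⟨z, hz, ha, he⟩ := hL.parent y hy hr
      have := G.one_le_len ha
      have hw := ih (lev z) (by omega) z hz (by omega) rfl
      rw [← hN, he, add_comm]
      exact (Walk.single (H := {z ∈ H | lev z ≤ c}) ⟨hy, hc⟩ ⟨hz, by omega⟩ ha).trans hw

theorem IsLevel.isConnected_ball (hL : G.IsLevel H root lev) (c : ℕ) :
    G.IsConnected {z ∈ H | lev z ≤ c} :=
  isConnected_of_center (x := root) ⟨hL.root_mem, hL.lev_root ▸ Nat.zero_le c⟩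
    fun y hy => (hL.walk_root c y hy.1 hy.2).symm.connectedWithin

/-- The leg of `v` above the level `c`: the part above `c` of a shortest walk from `v` to the
root. -/
theorem IsLevel.exists_leg (hL : G.IsLevel H root lev) (c : ℕ) (v : V) (hv : v ∈ H)
    (hc : c < lev v) :
    ∃ L : Set V, v ∈ L ∧
      (∀ y ∈ L, y ∈ H ∧ c < lev y ∧
        G.Walk {z ∈ H | lev y ≤ lev z ∧ lev z ≤ lev v} v (lev v - lev y) y) ∧
      (∀ y ∈ L, ConnectedWithin G.Adj L v y) ∧
      (∃ y ∈ L, ∃ z ∈ H, G.Adj y z ∧ lev z ≤ c) ∧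
      ∀ a, c ≤ a → a < lev v → ∃ y ∈ L, a < lev y ∧ lev y ≤ a + W := by
  induction hN : lev v using Nat.strong_induction_on generalizing v with
  | _ N ih =>
    subst hN
    have hr : v ≠ root := fun h => by rw [h, hL.lev_root] at hc; omega
    obtain ⟨u, hu, ha, he⟩ := hL.parent v hv hr
    have h1 := G.one_le_len ha
    have hW := G.len_le ha
    have hself : v ∈ H ∧ c < lev v ∧
        G.Walk {z ∈ H | lev v ≤ lev z ∧ lev z ≤ lev v} v (lev v - lev v) v :=
      ⟨hv, hc, by rw [Nat.sub_self]; exact .nil ⟨hv, le_rfl, le_rfl⟩⟩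
    by_cases hcu : lev u ≤ c
    · refine ⟨{v}, rfl, ?_, ?_, ⟨v, rfl, u, hu, ha, hcu⟩, fun a hca hav => ⟨v, rfl, hav, by omega⟩⟩
      · rintro y rfl; exact hself
      · rintro y rfl; exact .refl
    · push Not at hcu
      obtain ⟨L, huL, hLw, hLc, ⟨y, hyL, z, hz⟩, hLa⟩ := ih (lev u) (by omega) u hu hcu rfl
      refine ⟨insert v L, Set.mem_insert _ _, ?_, ?_, ⟨y, Or.inr hyL, z, hz⟩, ?_⟩
      · rintro y (rfl | hy)
        · exact hself
        · obtain ⟨hyH, hcy, hw⟩ := hLw y hy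
          have hyu : lev y ≤ lev u := hw.right_mem.2.2
          refine ⟨hyH, hcy, ?_⟩
          rw [show lev v - lev y = G.len v u + (lev u - lev y) by omega]
          refine (Walk.single ?_ ?_ ha).trans (hw.mono fun z hz => ⟨hz.1, hz.2.1, ?_⟩)
          · exact ⟨hv, by omega, le_rfl⟩
          · exact ⟨hu, by omega, by omega⟩
          · exact hz.2.2.trans (by omega)
      · rintro y (rfl | hy)
        · exact .refl
        · exact Relation.ReflTransGen.head ⟨ha, Or.inr huL⟩
            (connectedWithin_mono (Set.subset_insert _ _) (hLc y hy))
      · intro a hca hav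
        by_cases hau : a < lev u
        · obtain ⟨y, hy, h⟩ := hLa a hca hau
          exact ⟨y, Or.inr hy, h⟩
        · exact ⟨v, Or.inl rfl, hav, by omega⟩

end Level

/-! ### Iterated chopping produces a `K_{3,3}` minor -/

variable (G)

/-- The part of a `K_{3,3}` minor found inside `H`: all three branch sets `A i` of one side, and
`s` of the branch sets `B l` of the other side. Every `A i` has a distinguished vertex `v i` at
distance more than `Δ`, inside `H`, from the other branch sets, and these vertices are at distance
more than `R` from each other in the whole graph. -/
structure PartialMinor (H : Set V) (Δ R s : ℕ) (A : Fin 3 → Set V) (v : Fin 3 → V)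
    (B : ℕ → Set V) : Prop where
  mem : ∀ i, v i ∈ A i
  subset_left : ∀ i, A i ⊆ H
  subset_right : ∀ l < s, B l ⊆ H
  nonempty_right : ∀ l < s, (B l).Nonempty
  connected_left : ∀ i, G.IsConnected (A i)
  connected_right : ∀ l < s, G.IsConnected (B l)
  disjoint_left : ∀ i j, i ≠ j → Disjoint (A i) (A j)
  disjoint_right : ∀ l < s, ∀ m < s, l ≠ m → Disjoint (B l) (B m)
  disjoint_left_right : ∀ i, ∀ l < s, Disjoint (A i) (B l)
  adj : ∀ i, ∀ l < s, ∃ x ∈ A i, ∃ y ∈ B l, G.Adj x y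
  far_left : ∀ i j, i ≠ j → ∀ p ∈ A j, ∀ n, G.Walk H (v i) n p → Δ < n
  far_right : ∀ i, ∀ l < s, ∀ p ∈ B l, ∀ n, G.Walk H (v i) n p → Δ < n
  far : ∀ i j, i ≠ j → ∀ n, G.Walk Set.univ (v i) n (v j) → R < n

variable {G}

theorem PartialMinor.isK33Minor {Δ R : ℕ} {A : Fin 3 → Set V} {v : Fin 3 → V} {B : ℕ → Set V}
    (h : G.PartialMinor H Δ R 3 A v B) : IsK33Minor G.Adj A (fun l => B l) where
  nonempty_left i := ⟨v i, h.mem i⟩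
  nonempty_right l := h.nonempty_right l l.2
  connected_left := h.connected_left
  connected_right l := h.connected_right l l.2
  disjoint_left := h.disjoint_left
  disjoint_right l m hlm := h.disjoint_right l l.2 m m.2 (Fin.val_injective.ne hlm)
  disjoint_left_right i l := h.disjoint_left_right i l l.2
  adj i l := h.adj i l l.2

/-- If `H` is a component of a band of width `Δ` around the root of `H₀`, then a partial minor in
`H` extends to `H₀`: prolong each `A i` by the leg of `v i`, and take a ball around the root as new
branch set. The new distinguished vertices lie halfway down the legs. -/
theorem PartialMinor.extend {H₀ : Set V} {root : V} {lev : V → ℕ} (hL : G.IsLevel H₀ root lev)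
    {Δ R s D : ℕ} (hH : H ⊆ H₀) (hD : ∀ y ∈ H, D ≤ lev y ∧ lev y ≤ D + Δ)
    (hconv : ∀ y ∈ H, ∀ z ∈ H₀, G.Adj y z → (∃ p ∈ H, lev p ≤ lev z) →
      (∃ q ∈ H, lev z ≤ lev q) → z ∈ H)
    (hW : W < Δ) (hR : 9 * Δ ≤ R) {A : Fin 3 → Set V} {v : Fin 3 → V} {B : ℕ → Set V}
    (h : G.PartialMinor H Δ R s A v B) :
    ∃ A' v' B', G.PartialMinor H₀ Δ (R - 8 * Δ) (s + 1) A' v' B' := by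
  have hvH : ∀ i, v i ∈ H := fun i => h.subset_left i (h.mem i)
  have hvD : ∀ i, D ≤ lev (v i) ∧ lev (v i) ≤ D + Δ := fun i => hD _ (hvH i)
  -- the root is far from `H`, since it is within `D + Δ` of both `v 0` and `v 1`
  have hD3 : 3 * Δ < D := by
    have w0 := (hL.walk_root (lev (v 0)) _ (hH (hvH 0)) le_rfl).mono (Set.subset_univ _)
    have w1 := (hL.walk_root (lev (v 1)) _ (hH (hvH 1)) le_rfl).mono (Set.subset_univ _)
    have := h.far 0 1 (by decide) _ (w0.trans w1.symm)
    have := hvD 0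
    have := hvD 1
    omega
  set c := D - 3 * Δ with hc
  choose L hvL hLw hLc hLe hLa using fun i =>
    hL.exists_leg c (v i) (hH (hvH i)) (by have := hvD i; omega)
  choose v' hv'L hv'1 hv'2 using fun i => hLa i (D - 2 * Δ) (by omega) (by have := hvD i; omega)
  have hLlen : ∀ i, ∀ y ∈ L i, ∃ n ≤ 4 * Δ, G.Walk Set.univ (v i) n y := fun i y hy => by
    obtain ⟨-, hcy, hw⟩ := hLw i y hy
    exact ⟨_, by have := hvD i; omega, hw.mono (Set.subset_univ _)⟩
  -- the part of a leg inside the band stays in `H`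
  have hstay : ∀ i, ∀ p ∈ L i, p ∈ H → ∃ n ≤ Δ, G.Walk H (v i) n p := by
    intro i p hp hpH
    obtain ⟨-, -, hw⟩ := hLw i p hp
    refine ⟨lev (v i) - lev p, by have := hvD i; have := hD p hpH; omega, ?_⟩
    have key : ∀ n y, G.Walk {z ∈ H₀ | lev p ≤ lev z ∧ lev z ≤ lev (v i)} (v i) n y →
        G.Walk H (v i) n y := by
      intro n y hw
      induction hw with
      | nil _ => exact .nil (hvH i)
      | snoc _ ha hz ih =>
        exact .snoc ih ha (hconv _ ih.right_mem _ hz.1 ha ⟨p, hpH, hz.2.1⟩ ⟨_, hvH i, hz.2.2⟩)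
    exact key _ _ hw
  have hLA : ∀ i j, i ≠ j → Disjoint (L i) (A j) := fun i j hij =>
    Set.disjoint_left.2 fun p hp hpA => by
      obtain ⟨n, hn, hw⟩ := hstay i p hp (h.subset_left j hpA)
      have := h.far_left i j hij p hpA n hw
      omega
  have hLB : ∀ i, ∀ l < s, Disjoint (L i) (B l) := fun i l hl =>
    Set.disjoint_left.2 fun p hp hpB => by
      obtain ⟨n, hn, hw⟩ := hstay i p hp (h.subset_right l hl hpB)
      have := h.far_right i l hl p hpB n hw
      omega
  have hLL : ∀ i j, i ≠ j → Disjoint (L i) (L j) := fun i j hij =>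
    Set.disjoint_left.2 fun p hp hp' => by
      obtain ⟨n, hn, hw⟩ := hLlen i p hp
      obtain ⟨n', hn', hw'⟩ := hLlen j p hp'
      have := h.far i j hij _ (hw.trans hw'.symm)
      omega
  set C : Set V := {z ∈ H₀ | lev z ≤ c} with hC
  have hCH : Disjoint H C := Set.disjoint_left.2 fun p hp hpC => by
    have := hD p hp; have := hpC.2; omega
  have hCL : ∀ i, Disjoint (L i) C := fun i => Set.disjoint_left.2 fun p hp hpC => by
    have := (hLw i p hp).2.1; have := hpC.2; omega
  have hLsub : ∀ i, L i ⊆ H₀ := fun i y hy => (hLw i y hy).1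
  -- levels show that the new distinguished vertices are far from `H` and from the ball
  have hfarH : ∀ i, ∀ p ∈ H, ∀ n, G.Walk H₀ (v' i) n p → Δ < n := fun i p hp n hw => by
    have := hL.lev_le_of_walk hw
    have := hD p hp
    have := hv'2 i
    omega
  have hB : ∀ l < s, Function.update B s C l = B l := fun l hl =>
    Function.update_of_ne hl.ne _ _
  have hBs : Function.update B s C s = C := Function.update_self _ _ _
  refine ⟨fun i => A i ∪ L i, v', Function.update B s C, ?_⟩
  refine
    { mem := fun i => Or.inr (hv'L i)
      subset_left := fun i => Set.union_subset ((h.subset_left i).trans hH) (hLsub i)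
      subset_right := fun l hl => ?_
      nonempty_right := fun l hl => ?_
      connected_left := fun i => ?_
      connected_right := fun l hl => ?_
      disjoint_left := fun i j hij => ?_
      disjoint_right := fun l hl m hm hlm => ?_
      disjoint_left_right := fun i l hl => ?_
      adj := fun i l hl => ?_
      far_left := fun i j hij p hp n hw => ?_
      far_right := fun i l hl p hp n hw => ?_
      far := fun i j hij n hw => ?_ }
  · rcases Nat.lt_succ_iff_lt_or_eq.1 hl with hl | rfl
    · rw [hB l hl]; exact (h.subset_right l hl).trans hH
    · rw [hBs]; exact fun z hz => hz.1
  · rcases Nat.lt_succ_iff_lt_or_eq.1 hl with hl | rfl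
    · rw [hB l hl]; exact h.nonempty_right l hl
    · rw [hBs]; exact ⟨root, hL.root_mem, hL.lev_root ▸ Nat.zero_le c⟩
  · refine isConnected_of_center (x := v i) (Or.inl (h.mem i)) ?_
    rintro y (hy | hy)
    · exact connectedWithin_mono Set.subset_union_left (h.connected_left i _ (h.mem i) _ hy)
    · exact connectedWithin_mono Set.subset_union_right (hLc i y hy)
  · rcases Nat.lt_succ_iff_lt_or_eq.1 hl with hl | rfl
    · rw [hB l hl]; exact h.connected_right l hl
    · rw [hBs]; exact hL.isConnected_ball c
  · simp only [Set.disjoint_union_left, Set.disjoint_union_right]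
    exact ⟨⟨h.disjoint_left i j hij, hLA i j hij⟩, (hLA j i hij.symm).symm, hLL i j hij⟩
  · rcases Nat.lt_succ_iff_lt_or_eq.1 hl with hl | rfl <;>
      rcases Nat.lt_succ_iff_lt_or_eq.1 hm with hm | rfl
    · rw [hB l hl, hB m hm]; exact h.disjoint_right l hl m hm hlm
    · rw [hB l hl, hBs]; exact hCH.mono_left (h.subset_right l hl)
    · rw [hB m hm, hBs]; exact (hCH.mono_left (h.subset_right m hm)).symm
    · exact absurd rfl hlm
  · rw [Set.disjoint_union_left]
    rcases Nat.lt_succ_iff_lt_or_eq.1 hl with hl | rfl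
    · rw [hB l hl]; exact ⟨h.disjoint_left_right i l hl, hLB i l hl⟩
    · rw [hBs]; exact ⟨hCH.mono_left (h.subset_left i), hCL i⟩
  · rcases Nat.lt_succ_iff_lt_or_eq.1 hl with hl | rfl
    · rw [hB l hl]
      obtain ⟨x, hx, y, hy, hxy⟩ := h.adj i l hl
      exact ⟨x, Or.inl hx, y, hy, hxy⟩
    · rw [hBs]
      obtain ⟨y, hy, z, hz, ha, hzc⟩ := hLe i
      exact ⟨y, Or.inr hy, z, ⟨hz, hzc⟩, ha⟩
  · rcases hp with hp | hp
    · exact hfarH i p (h.subset_left j hp) n hw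
    · obtain ⟨n₁, hn₁, hw₁⟩ := hLlen i _ (hv'L i)
      obtain ⟨n₂, hn₂, hw₂⟩ := hLlen j p hp
      have := h.far i j hij _ ((hw₁.trans (hw.mono (Set.subset_univ _))).trans hw₂.symm)
      omega
  · rcases Nat.lt_succ_iff_lt_or_eq.1 hl with hl | rfl
    · rw [hB l hl] at hp
      exact hfarH i p (h.subset_right l hl hp) n hw
    · rw [hBs] at hp
      have := hL.lev_le_of_walk hw.symm
      have := hp.2
      have := hv'1 i
      omega
  · obtain ⟨n₁, hn₁, hw₁⟩ := hLlen i _ (hv'L i)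
    obtain ⟨n₂, hn₂, hw₂⟩ := hLlen j _ (hv'L j)
    have := h.far i j hij _ ((hw₁.trans hw).trans hw₂.symm)
    omega

variable (G)

/-- The sets obtained by chopping `k` times: a set obtained in one chop from a connected set `H₀`
is a connected piece of a band of width `Δ` of levels of `H₀`, and no edge of the band leaves
it. -/
inductive IsChopped (Δ : ℕ) : ℕ → Set V → Prop
  | zero {H : Set V} : G.IsConnected H → IsChopped Δ 0 H
  | succ {k : ℕ} {H₀ H : Set V} {root : V} {lev : V → ℕ} {D : ℕ} : IsChopped Δ k H₀ →
      G.IsLevel H₀ root lev → G.IsConnected H → H ⊆ H₀ →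
      (∀ y ∈ H, D ≤ lev y ∧ lev y ≤ D + Δ) →
      (∀ y ∈ H, ∀ z ∈ H₀, G.Adj y z → (∃ p ∈ H, lev p ≤ lev z) →
        (∃ q ∈ H, lev z ≤ lev q) → z ∈ H) → IsChopped Δ (k + 1) H

variable {G}

theorem IsChopped.isConnected {Δ k : ℕ} (h : G.IsChopped Δ k H) : G.IsConnected H := by
  cases h <;> assumption

theorem IsChopped.exists_partialMinor {Δ k : ℕ} (hW : W < Δ) (h : G.IsChopped Δ k H) {R s : ℕ}
    (hR : (8 * k + 1) * Δ ≤ R) {A : Fin 3 → Set V} {v : Fin 3 → V} {B : ℕ → Set V}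
    (hm : G.PartialMinor H Δ R s A v B) :
    ∃ H' R' A' v' B', G.PartialMinor H' Δ R' (s + k) A' v' B' := by
  induction h generalizing R s A v B with
  | zero _ => exact ⟨_, _, _, _, _, hm⟩
  | @succ k _ _ _ _ _ _ hL _ hH hD hconv ih =>
    have : (8 * k + 1) * Δ + 8 * Δ = (8 * (k + 1) + 1) * Δ := by ring
    have : 0 ≤ k * Δ := Nat.zero_le _
    obtain ⟨A', v', B', hm'⟩ := hm.extend hL hH hD hconv hW (by nlinarith)
    obtain ⟨H', R', A'', v'', B'', h'⟩ := ih (by omega) hm'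
    exact ⟨H', R', A'', v'', B'', by rwa [add_assoc, add_comm 1] at h'⟩

/-- A set of large diameter contains three vertices that are far from each other. -/
theorem IsConnected.exists_three_far (hH : G.IsConnected H) {R : ℕ} (hR : W ≤ R) (hx : x ∈ H)
    (hy : y ∈ H) (hxy : ∀ n, G.Walk Set.univ x n y → 3 * R < n) :
    ∃ z ∈ H, (∀ n, G.Walk Set.univ x n z → R < n) ∧ ∀ n, G.Walk Set.univ z n y → R < n := by
  have key : ∀ w, ConnectedWithin G.Adj H x w → (∀ n, G.Walk Set.univ x n w → R < n) →
      ∃ z ∈ H, (∀ n, G.Walk Set.univ x n z → R < n) ∧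
        ∃ n ≤ R + W, G.Walk Set.univ x n z := by
    intro w hw
    induction hw with
    | refl => intro h; exact absurd (h 0 (.nil trivial)) (Nat.not_lt_zero _)
    | @tail u w _ hbc ih =>
      intro h
      by_cases hu : ∀ n, G.Walk Set.univ x n u → R < n
      · exact ih hu
      · push Not at hu
        obtain ⟨n, hn, hnR⟩ := hu
        exact ⟨w, hbc.2, h, _, add_le_add hnR (G.len_le hbc.1), hn.snoc hbc.1 trivial⟩
  obtain ⟨z, hz, h1, n, hn, hw⟩ := key y (hH x hx y hy) fun n hn => by have := hxy n hn; omega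
  refine ⟨z, hz, h1, fun m hm => ?_⟩
  have := hxy _ (hw.trans hm)
  omega

/-- In a graph without `K_{3,3}` minor, three chops leave only pieces of bounded diameter. -/
theorem IsChopped.exists_walk_le {Δ : ℕ} (hW : W < Δ)
    (hG : ∀ A B : Fin 3 → Set V, ¬ IsK33Minor G.Adj A B) (h : G.IsChopped Δ 3 H) (hx : x ∈ H)
    (hy : y ∈ H) : ∃ n ≤ 75 * Δ, G.Walk Set.univ x n y := by
  by_contra! hcon
  -- each of the three extensions costs `8 * Δ` and needs `9 * Δ`, so start with `25 * Δ`
  obtain ⟨z, hz, hxz, hzy⟩ := h.isConnected.exists_three_far (R := 25 * Δ) (by omega) hx hy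
    fun n hn => by
      by_contra! hle
      exact hcon n (by omega) hn
  have hxy : ∀ n, G.Walk Set.univ x n y → 25 * Δ < n := fun n hn => by
    by_contra! hle
    exact hcon n (by omega) hn
  have hfar : ∀ i j : Fin 3, i ≠ j → ∀ n,
      G.Walk Set.univ (![x, y, z] i) n (![x, y, z] j) → 25 * Δ < n := by
    intro i j hij n hn
    fin_cases i <;> fin_cases j <;> simp at hij hn
    · exact hxy n hn
    · exact hxz n hn
    · exact hxy n hn.symm
    · exact hzy n hn.symm
    · exact hxz n hn.symm
    · exact hzy n hn
  have hm : G.PartialMinor H Δ (25 * Δ) 0 (fun i => {![x, y, z] i}) ![x, y, z] fun _ => ∅ :=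
    { mem := fun i => rfl
      subset_left := fun i => by
        rw [Set.singleton_subset_iff]
        fin_cases i <;> simpa
      subset_right := fun l hl => absurd hl (Nat.not_lt_zero _)
      nonempty_right := fun l hl => absurd hl (Nat.not_lt_zero _)
      connected_left := fun i a ha b hb => by
        rw [Set.mem_singleton_iff.1 ha, Set.mem_singleton_iff.1 hb]; exact .refl
      connected_right := fun l hl => absurd hl (Nat.not_lt_zero _)
      disjoint_left := fun i j hij => by
        rw [Set.disjoint_singleton]
        intro he
        have := hfar i j hij 0 (he ▸ .nil trivial)
        omega
      disjoint_right := fun l hl => absurd hl (Nat.not_lt_zero _)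
      disjoint_left_right := fun i l hl => absurd hl (Nat.not_lt_zero _)
      adj := fun i l hl => absurd hl (Nat.not_lt_zero _)
      far_left := fun i j hij p hp n hw => by
        rw [Set.mem_singleton_iff.1 hp] at hw
        have := hfar i j hij n (hw.mono (Set.subset_univ _))
        omega
      far_right := fun i l hl => absurd hl (Nat.not_lt_zero _)
      far := hfar }
  obtain ⟨_, _, A, v, B, hm'⟩ := h.exists_partialMinor hW (by omega) hm
  rw [zero_add] at hm'
  exact hG _ _ hm'.isK33Minor

end LengthGraph

namespace LengthGraph

variable {V : Type*} {W : ℕ} (G : LengthGraph V W) {H : Set V} {x y z : V}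

/-! ### Random partitions into pieces of bounded diameter -/

/-- The component of `x` in the subgraph induced by `H`. -/
def component (H : Set V) (x : V) : Set V := {y | ConnectedWithin G.Adj H x y}

variable {G}

theorem self_mem_component : x ∈ G.component H x := Relation.ReflTransGen.refl

theorem component_subset (hx : x ∈ H) : G.component H x ⊆ H := fun _ hy =>
  (exists_walk hx hy).choose_spec.right_mem

theorem mem_component_of_adj (hy : y ∈ G.component H x) (hz : z ∈ H) (h : G.Adj y z) :
    z ∈ G.component H x :=
  Relation.ReflTransGen.tail hy ⟨h, hz⟩

theorem isConnected_component : G.IsConnected (G.component H x) := by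
  refine isConnected_of_center self_mem_component fun y hy => ?_
  refine Relation.ReflTransGen.head_induction_on (motive := fun a _ =>
    a ∈ G.component H x → ConnectedWithin G.Adj (G.component H x) a y) hy ?_ ?_ self_mem_component
  · exact fun _ => .refl
  · intro a b hab _ ih ha
    have hb := mem_component_of_adj ha hab.2 hab.1
    exact .head ⟨hab.1, hb⟩ (ih hb)

theorem component_eq (hx : x ∈ H) (hy : y ∈ G.component H x) :
    G.component H y = G.component H x :=
  Set.ext fun _ => ⟨fun hz => Relation.ReflTransGen.trans hy hz, fun hz =>
    Relation.ReflTransGen.trans (connectedWithin_symm hx hy) hz⟩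

variable (G)

/-- The function `cl`, assigning to each vertex its cluster, describes a partition into sets
obtained by chopping `k` times with width `16 * W`. -/
structure IsChoppedPartition (k : ℕ) (cl : V → Set V) : Prop where
  mem : ∀ x, x ∈ cl x
  eq : ∀ x, ∀ y ∈ cl x, cl y = cl x
  chopped : ∀ x, G.IsChopped (16 * W) k (cl x)

/-- The vertex `x` is padded if its cluster contains the ball of radius `W` around it. -/
def IsPadded (cl : V → Set V) (x : V) : Prop :=
  ∀ n ≤ W, ∀ y, G.Walk Set.univ x n y → G.Walk (cl x) x n y

/-- The index of the band containing the level `a`, for bands of width `16 * W` and offset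
`j * W`. -/
def bandIndex (W j a : ℕ) : ℕ := (a / W + j) / 16

/-- Chop each cluster of `cl` into the connected pieces of the bands, with offset `j`, of the level
functions `lev`. -/
def chop (lev : Set V → V → ℕ) (cl : V → Set V) (j : ℕ) (x : V) : Set V :=
  G.component {z ∈ cl x | bandIndex W j (lev (cl x) z) = bandIndex W j (lev (cl x) x)} x

variable {G}

theorem bandIndex_mono (W j : ℕ) : Monotone (bandIndex W j) := fun _ _ h =>
  Nat.div_le_div_right (Nat.add_le_add_right (Nat.div_le_div_right h) _)

theorem bandIndex_spread (hW : 0 < W) (j q : ℕ) :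
    ∃ D, ∀ a, bandIndex W j a = q → D ≤ a ∧ a ≤ D + 16 * W := by
  refine ⟨(16 * q - j) * W, fun a ha => ?_⟩
  unfold bandIndex at ha
  have h1 : 16 * q - j ≤ a / W := by generalize a / W = u at *; omega
  have h2 : a / W < 16 * q - j + 16 := by generalize a / W = u at *; omega
  exact ⟨(Nat.le_div_iff_mul_le hW).1 h1, by
    have := (Nat.div_lt_iff_lt_mul hW).1 h2
    rw [add_mul] at this
    exact this.le⟩

/-- Away from the boundaries between bands, points at distance at most `W` lie in the same band. -/
theorem bandIndex_eq (hW : 0 < W) {j a b : ℕ} (h1 : (a / W + j) % 16 ≠ 0)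
    (h2 : (a / W + j) % 16 ≠ 15) (hab : a ≤ b + W) (hba : b ≤ a + W) :
    bandIndex W j b = bandIndex W j a := by
  have h3 := Nat.div_le_div_right (c := W) hab
  have h4 := Nat.div_le_div_right (c := W) hba
  rw [Nat.add_div_right _ hW] at h3 h4
  unfold bandIndex
  generalize a / W = u at *
  generalize b / W = v at *
  omega

theorem IsChoppedPartition.chop {k : ℕ} {cl : V → Set V} (h : G.IsChoppedPartition k cl)
    (hW : 0 < W) {lev : Set V → V → ℕ}
    (hlev : ∀ H, G.IsConnected H → H.Nonempty → ∃ root, G.IsLevel H root (lev H)) (j : ℕ) :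
    G.IsChoppedPartition (k + 1) (G.chop lev cl j) where
  mem x := self_mem_component
  eq x y hy := by
    have hx : x ∈ {z ∈ cl x | bandIndex W j (lev (cl x) z) = bandIndex W j (lev (cl x) x)} :=
      ⟨h.mem x, rfl⟩
    have hyS := component_subset hx hy
    unfold LengthGraph.chop
    rw [h.eq x y hyS.1, hyS.2]
    exact component_eq hx hy
  chopped x := by
    have hx : x ∈ {z ∈ cl x | bandIndex W j (lev (cl x) z) = bandIndex W j (lev (cl x) x)} :=
      ⟨h.mem x, rfl⟩
    have hsub := component_subset (G := G) hx
    obtain ⟨root, hL⟩ := hlev (cl x) (h.chopped x).isConnected ⟨x, h.mem x⟩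
    obtain ⟨D, hD⟩ := bandIndex_spread hW j (bandIndex W j (lev (cl x) x))
    refine .succ (h.chopped x) hL isConnected_component (fun y hy => (hsub hy).1)
      (fun y hy => hD _ (hsub hy).2) ?_
    rintro y hy z hz ha ⟨p, hp, hpz⟩ ⟨q, hq, hzq⟩
    refine mem_component_of_adj hy ⟨hz, le_antisymm ?_ ?_⟩ ha
    · exact (bandIndex_mono W j hzq).trans (hsub hq).2.le
    · exact (hsub hp).2.ge.trans (bandIndex_mono W j hpz)

theorem IsPadded.chop {k : ℕ} {cl : V → Set V} (h : G.IsChoppedPartition k cl)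
    (hW : 0 < W) {lev : Set V → V → ℕ}
    (hlev : ∀ H, G.IsConnected H → H.Nonempty → ∃ root, G.IsLevel H root (lev H)) {j : ℕ}
    (hx : G.IsPadded cl x) (h1 : (lev (cl x) x / W + j) % 16 ≠ 0)
    (h2 : (lev (cl x) x / W + j) % 16 ≠ 15) : G.IsPadded (G.chop lev cl j) x := by
  obtain ⟨root, hL⟩ := hlev (cl x) (h.chopped x).isConnected ⟨x, h.mem x⟩
  intro n hn y hy
  have hw := hx n hn y hy
  clear hy
  induction hw with
  | nil _ => exact .nil self_mem_component
  | @snoc n y z hw ha hz ih =>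
    have hw' := ih (by omega)
    refine .snoc hw' ha (mem_component_of_adj hw'.right_mem ⟨hz, ?_⟩ ha)
    have hwz := Walk.snoc hw ha hz
    have := hL.lev_le_of_walk hwz
    have := hL.lev_le_of_walk hwz.symm
    exact bandIndex_eq hW h1 h2 (by omega) (by omega)

/-- Two of the sixteen offsets put the level `u * W` within `W` of a boundary between bands. -/
theorem card_good_offsets (u : ℕ) :
    14 ≤ (Finset.univ.filter fun j : Fin 16 =>
      (u + j) % 16 ≠ 0 ∧ (u + j) % 16 ≠ 15).card := by
  have key : ∀ v : Fin 16, 14 ≤ (Finset.univ.filter fun j : Fin 16 =>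
      (v.val + j) % 16 ≠ 0 ∧ (v.val + j) % 16 ≠ 15).card := by decide
  have := key ⟨u % 16, Nat.mod_lt _ (by norm_num)⟩
  simpa only [Nat.mod_add_mod] using this

open Classical in
/-- There is a finite family of `k` times chopped partitions such that each vertex is padded for a
proportion at least `(14 / 16) ^ k` of them. -/
theorem exists_choppedPartitions (hW : 0 < W) (k : ℕ) :
    ∃ (ι : Type) (_ : Fintype ι) (_ : Nonempty ι) (cl : ι → V → Set V),
      (∀ i, G.IsChoppedPartition k (cl i)) ∧ ∀ x, 14 ^ k * Fintype.card ι ≤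
        16 ^ k * (Finset.univ.filter fun i => G.IsPadded (cl i) x).card := by
  induction k with
  | zero =>
    refine ⟨Unit, inferInstance, inferInstance, fun _ x => G.component Set.univ x, fun _ =>
      ⟨fun x => self_mem_component, fun x y hy => component_eq trivial hy,
        fun x => .zero isConnected_component⟩, fun x => ?_⟩
    have : G.IsPadded (fun x => G.component Set.univ x) x := by
      intro n _ y hy
      induction hy with
      | nil _ => exact .nil self_mem_component
      | snoc _ ha _ ih =>
        have ih := ih (by omega)
        exact .snoc ih ha (mem_component_of_adj ih.right_mem trivial ha)
    simp [this]
  | succ k ih =>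
    obtain ⟨ι, _, _, cl, hcl, hpad⟩ := ih
    have hlev : ∀ H, ∃ lev : V → ℕ, G.IsConnected H → H.Nonempty →
        ∃ root, G.IsLevel H root lev := by
      intro H
      by_cases hH : G.IsConnected H ∧ H.Nonempty
      · obtain ⟨hc, r, hr⟩ := hH
        obtain ⟨lev, hl⟩ := hc.exists_isLevel hr
        exact ⟨lev, fun _ _ => ⟨r, hl⟩⟩
      · exact ⟨0, fun h h' => absurd ⟨h, h'⟩ hH⟩
    choose lev hlev using hlev
    refine ⟨ι × Fin 16, inferInstance, inferInstance, fun i => G.chop lev (cl i.1) i.2,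
      fun i => (hcl i.1).chop hW hlev _, fun x => ?_⟩
    have hcard : 14 * (Finset.univ.filter fun i => G.IsPadded (cl i) x).card ≤
        (Finset.univ.filter fun i : ι × Fin 16 =>
          G.IsPadded (G.chop lev (cl i.1) i.2) x).card := by
      have hsub : ((Finset.univ.filter fun i => G.IsPadded (cl i) x).sigma fun i =>
          Finset.univ.filter fun j : Fin 16 => (lev (cl i x) x / W + j) % 16 ≠ 0 ∧
            (lev (cl i x) x / W + j) % 16 ≠ 15).card ≤
          (Finset.univ.filter fun i : ι × Fin 16 =>
            G.IsPadded (G.chop lev (cl i.1) i.2) x).card := by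
        refine Finset.card_le_card_of_injOn (fun a => (a.1, a.2)) ?_ ?_
        · rintro ⟨i, j⟩ hij
          simp only [Finset.coe_sigma, Finset.coe_filter, Finset.mem_univ, true_and,
            Set.mem_sigma_iff, Set.mem_ofPred_eq] at hij ⊢
          exact hij.1.chop (hcl i) hW hlev hij.2.1 hij.2.2
        · rintro ⟨i, j⟩ _ ⟨i', j'⟩ _ h
          obtain ⟨rfl, rfl⟩ := Prod.mk.inj h
          rfl
      refine le_trans ?_ hsub
      rw [Finset.card_sigma, mul_comm, ← smul_eq_mul]
      exact Finset.card_nsmul_le_sum _ _ _ fun i _ => card_good_offsets _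
    rw [Fintype.card_prod, Fintype.card_fin]
    calc 14 ^ (k + 1) * (Fintype.card ι * 16) = 14 * 16 * (14 ^ k * Fintype.card ι) := by ring
      _ ≤ 14 * 16 * (16 ^ k * _) := Nat.mul_le_mul_left _ (hpad x)
      _ = 16 ^ (k + 1) * (14 * _) := by ring
      _ ≤ _ := Nat.mul_le_mul_left _ hcard

open Classical in
/-- Padded decomposition of graphs without `K_{3,3}` minor: there is a finite family of partitions
into pieces of diameter at most `1200 * W` such that each ball of radius `W` is contained in a
piece for at least half of them. -/
theorem exists_padded_partitions (hW : 0 < W)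
    (hG : ∀ A B : Fin 3 → Set V, ¬ IsK33Minor G.Adj A B) :
    ∃ (ι : Type) (_ : Fintype ι) (_ : Nonempty ι) (cl : ι → V → Set V),
      (∀ i x y, cl i x = cl i y → ∃ n ≤ 1200 * W, G.Walk Set.univ x n y) ∧
      ∀ x, Fintype.card ι ≤ 2 * (Finset.univ.filter fun i =>
        ∀ n ≤ W, ∀ y, G.Walk Set.univ x n y → cl i y = cl i x).card := by
  -- three chops suffice both for the minor and for `16 ^ 3 ≤ 2 * 14 ^ 3`
  obtain ⟨ι, i1, i2, cl, hcl, hpad⟩ := G.exists_choppedPartitions hW 3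
  refine ⟨ι, i1, i2, cl, fun i x y hxy => ?_, fun x => ?_⟩
  · obtain ⟨n, hn, hw⟩ := ((hcl i).chopped x).exists_walk_le (by omega) hG ((hcl i).mem x)
      (hxy ▸ (hcl i).mem y)
    exact ⟨n, by omega, hw⟩
  · have hsub : (Finset.univ.filter fun i => G.IsPadded (cl i) x).card ≤
        (Finset.univ.filter fun i =>
          ∀ n ≤ W, ∀ y, G.Walk Set.univ x n y → cl i y = cl i x).card := by
      refine Finset.card_le_card fun i hi => ?_
      simp only [Finset.mem_filter, Finset.mem_univ, true_and] at hi ⊢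
      exact fun n hn y hy => (hcl i).eq x y (hi n hn y hy).right_mem
    have := hpad x
    omega

end LengthGraph

/-! ### Expectations over the trajectories of a finite chain -/

/-- `P` is a stochastic matrix which is reversible with respect to the probability vector `π`. -/
structure IsReversibleChain {S : Type*} [Fintype S] (P : Matrix S S ℝ) (π : S → ℝ) : Prop where
  nonneg : ∀ s t, 0 ≤ P s t
  row_sum : ∀ s, ∑ t, P s t = 1
  init_nonneg : ∀ s, 0 ≤ π s
  init_sum : ∑ s, π s = 1
  detailed_balance : ∀ s t, π s * P s t = π t * P t s

section Expectation

variable {S : Type*}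

/-- A trajectory of length `n`, continued by its last value. -/
def extendTrajectory {n : ℕ} (y : Fin (n + 1) → S) (i : ℕ) : S :=
  y ⟨min i n, Nat.lt_succ_of_le (min_le_right i n)⟩

/-- The trajectory `x` up to time `n`, continued by `t`. -/
def continueWith (n : ℕ) (t : S) (x : ℕ → S) (i : ℕ) : S := if i ≤ n then x i else t

theorem extendTrajectory_snoc {n : ℕ} (y : Fin (n + 1) → S) (t : S) :
    extendTrajectory (Fin.snoc y t : Fin (n + 2) → S) =
      continueWith n t (extendTrajectory y) := by
  funext i
  unfold extendTrajectory continueWith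
  by_cases hi : i ≤ n
  · rw [if_pos hi]
    have : (⟨min i (n + 1), Nat.lt_succ_of_le (min_le_right i (n + 1))⟩ : Fin (n + 2)) =
        Fin.castSucc ⟨min i n, Nat.lt_succ_of_le (min_le_right i n)⟩ := by
      ext; simp; omega
    rw [this, Fin.snoc_castSucc]
  · rw [if_neg hi]
    have : (⟨min i (n + 1), Nat.lt_succ_of_le (min_le_right i (n + 1))⟩ : Fin (n + 2)) =
        Fin.last (n + 1) := by
      ext; simp; omega
    rw [this, Fin.snoc_last]

variable [Fintype S] (P : Matrix S S ℝ) (π : S → ℝ)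

/-- The probability of the trajectory `y`. -/
def trajectoryWeight {n : ℕ} (y : Fin (n + 1) → S) : ℝ :=
  π (y 0) * ∏ i : Fin n, P (y i.castSucc) (y i.succ)

/-- The expectation of a function `F` of the trajectory of the chain, run up to time `n`. -/
def trajectoryExpectation (n : ℕ) (F : (ℕ → S) → ℝ) : ℝ :=
  ∑ y : Fin (n + 1) → S, trajectoryWeight P π y * F (extendTrajectory y)

local notation "𝔼" => trajectoryExpectation P π

theorem trajectoryExpectation_add (n : ℕ) (F F' : (ℕ → S) → ℝ) :
    𝔼 n (fun x => F x + F' x) = 𝔼 n F + 𝔼 n F' := by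
  simp [trajectoryExpectation, mul_add, Finset.sum_add_distrib]

theorem trajectoryExpectation_mul (n : ℕ) (c : ℝ) (F : (ℕ → S) → ℝ) :
    𝔼 n (fun x => c * F x) = c * 𝔼 n F := by
  simp only [trajectoryExpectation, Finset.mul_sum]
  exact Finset.sum_congr rfl fun _ _ => by ring

theorem trajectoryExpectation_sum (n : ℕ) {ι : Type*} (s : Finset ι) (F : ι → (ℕ → S) → ℝ) :
    𝔼 n (fun x => ∑ i ∈ s, F i x) = ∑ i ∈ s, 𝔼 n (F i) := by
  simp only [trajectoryExpectation, Finset.mul_sum]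
  exact Finset.sum_comm

theorem trajectoryExpectation_succ (n : ℕ) (F : (ℕ → S) → ℝ) :
    𝔼 (n + 1) F = 𝔼 n fun x => ∑ t, P (x n) t * F (continueWith n t x) := by
  unfold trajectoryExpectation
  rw [← (Fin.snocEquiv fun _ : Fin (n + 2) => S).sum_comp, Fintype.sum_prod_type,
    Finset.sum_comm]
  refine Finset.sum_congr rfl fun y _ => ?_
  rw [Finset.mul_sum]
  refine Finset.sum_congr rfl fun t _ => ?_
  have hn : extendTrajectory y n = y (Fin.last n) := by
    unfold extendTrajectory; congr 1; ext; simp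
  have : trajectoryWeight P π (Fin.snoc y t : Fin (n + 2) → S) =
      trajectoryWeight P π y * P (y (Fin.last n)) t := by
    unfold trajectoryWeight
    rw [Fin.prod_univ_castSucc]
    have h0 : (Fin.snoc y t : Fin (n + 2) → S) 0 = y 0 := Fin.snoc_castSucc (α := fun _ => S) t y 0
    have hl : (Fin.snoc y t : Fin (n + 2) → S) (Fin.last n).succ = t :=
      Fin.snoc_last (α := fun _ => S) t y
    have hs : ∀ i : Fin n, (Fin.snoc y t : Fin (n + 2) → S) i.castSucc.succ = y i.succ :=
      fun i => Fin.snoc_castSucc (α := fun _ => S) t y i.succ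
    have hc : ∀ i : Fin (n + 1), (Fin.snoc y t : Fin (n + 2) → S) i.castSucc = y i :=
      fun i => Fin.snoc_castSucc (α := fun _ => S) t y i
    simp only [h0, hl, hs, hc]
    ring
  change trajectoryWeight P π (Fin.snoc y t : Fin (n + 2) → S) *
    F (extendTrajectory (Fin.snoc y t : Fin (n + 2) → S)) = _
  rw [this, extendTrajectory_snoc, hn]
  ring

variable {P π}

theorem IsReversibleChain.weight_nonneg (h : IsReversibleChain P π) {n : ℕ}
    (y : Fin (n + 1) → S) : 0 ≤ trajectoryWeight P π y :=
  mul_nonneg (h.init_nonneg _) (Finset.prod_nonneg fun _ _ => h.nonneg _ _)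

theorem IsReversibleChain.expectation_mono (h : IsReversibleChain P π) (n : ℕ)
    {F F' : (ℕ → S) → ℝ} (hF : ∀ x, F x ≤ F' x) : 𝔼 n F ≤ 𝔼 n F' :=
  Finset.sum_le_sum fun y _ => mul_le_mul_of_nonneg_left (hF _) (h.weight_nonneg y)

theorem IsReversibleChain.expectation_eq (h : IsReversibleChain P π) {k n : ℕ} (hk : k ≤ n)
    {F : (ℕ → S) → ℝ} (hF : DependsOn F (Set.Iic k)) : 𝔼 n F = 𝔼 k F := by
  induction n, hk using Nat.le_induction with
  | base => rfl
  | succ n hkn ih =>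
    rw [trajectoryExpectation_succ, ← ih]
    congr 1
    funext x
    have : ∀ t, F (continueWith n t x) = F x := fun t => hF fun i hi => by
      have : i ≤ n := le_trans hi hkn
      simp [continueWith, this]
    simp only [this, ← Finset.sum_mul, h.row_sum, one_mul]

/-- The Markov property. -/
theorem IsReversibleChain.markov (h : IsReversibleChain P π) {k n : ℕ} (hk : k < n)
    {F : (ℕ → S) → ℝ} (hF : DependsOn F (Set.Iic k)) (g : S → S → ℝ) :
    𝔼 n (fun x => F x * g (x k) (x (k + 1))) =
      𝔼 n fun x => F x * ∑ t, P (x k) t * g (x k) t := by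
  rw [h.expectation_eq (k := k + 1) hk, h.expectation_eq (k := k) hk.le, trajectoryExpectation_succ]
  · congr 1
    funext x
    rw [Finset.mul_sum]
    refine Finset.sum_congr rfl fun t _ => ?_
    have : F (continueWith k t x) = F x := hF fun i hi => by
      have : i ≤ k := hi
      simp [continueWith, this]
    rw [this]
    simp [continueWith]
    ring
  · intro x x' hx
    simp only [hF hx, hx k (Set.mem_Iic.2 le_rfl)]
  · intro x x' hx
    simp only [hF fun i hi => hx i (Set.mem_Iic.2 (le_trans hi (Nat.le_succ k))),
      hx k (Set.mem_Iic.2 (Nat.le_succ k)), hx (k + 1) (Set.mem_Iic.2 le_rfl)]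

theorem IsReversibleChain.stationary (h : IsReversibleChain P π) {k n : ℕ} (hk : k ≤ n)
    (g : S → ℝ) : 𝔼 n (fun x => g (x k)) = ∑ s, π s * g s := by
  induction k generalizing g with
  | zero =>
    rw [h.expectation_eq (k := 0) (Nat.zero_le n)
      (fun x x' hx => by simp only [hx 0 (Set.mem_Iic.2 le_rfl)])]
    unfold trajectoryExpectation
    rw [← (Equiv.funUnique (Fin 1) S).symm.sum_comp]
    simp [trajectoryWeight, extendTrajectory]
  | succ k ih =>
    have := h.markov (k := k) hk (F := fun _ => 1) (fun _ _ _ => rfl) fun _ t => g t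
    simp only [one_mul] at this
    rw [this, ih (by omega) fun s => ∑ t, P s t * g t]
    simp only [Finset.mul_sum]
    rw [Finset.sum_comm]
    refine Finset.sum_congr rfl fun t _ => ?_
    simp only [← mul_assoc, ← Finset.sum_mul, h.detailed_balance _ t]
    rw [← Finset.mul_sum, h.row_sum, mul_one]

theorem IsReversibleChain.stationary_pair (h : IsReversibleChain P π) {k n : ℕ} (hk : k < n)
    (g : S → S → ℝ) :
    𝔼 n (fun x => g (x k) (x (k + 1))) = ∑ s, π s * ∑ t, P s t * g s t := by
  have := h.markov (k := k) hk (F := fun _ => 1) (fun _ _ _ => rfl) g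
  simp only [one_mul] at this
  rw [this, h.stationary hk.le fun s => ∑ t, P s t * g s t]

/-- The time reversal of a stationary reversible chain has the same law. -/
theorem IsReversibleChain.reversal (h : IsReversibleChain P π) (n : ℕ) (F : (ℕ → S) → ℝ) :
    𝔼 n (fun x => F fun i => x (n - i)) = 𝔼 n F := by
  have hw : ∀ (n : ℕ) (y : Fin (n + 1) → S),
      trajectoryWeight P π y = π (y (Fin.last n)) * ∏ i : Fin n, P (y i.succ) (y i.castSucc) := by
    intro n
    induction n with
    | zero => intro y; simp [trajectoryWeight]
    | succ n ih =>
      intro y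
      have := ih fun i => y i.castSucc
      unfold trajectoryWeight at this ⊢
      rw [Fin.prod_univ_castSucc, ← mul_assoc, Fin.prod_univ_castSucc]
      have e : π (y 0) * ∏ i : Fin n, P (y i.castSucc.castSucc) (y i.castSucc.succ) =
        π (y (Fin.last n).castSucc) *
          ∏ i : Fin n, P (y i.castSucc.succ) (y i.castSucc.castSucc) := this
      rw [e]
      have hb := h.detailed_balance (y (Fin.last n).castSucc) (y (Fin.last n).succ)
      rw [Fin.succ_last] at hb ⊢
      linear_combination (∏ i : Fin n, P (y i.castSucc.succ) (y i.castSucc.castSucc)) * hb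
  unfold trajectoryExpectation
  rw [← (Equiv.arrowCongr Fin.revPerm (Equiv.refl S)).sum_comp]
  refine Finset.sum_congr rfl fun y _ => ?_
  congr 1
  · rw [hw]
    unfold trajectoryWeight
    congr 1
    · simp [Equiv.arrowCongr]
    · rw [← Equiv.prod_comp Fin.revPerm]
      refine Finset.prod_congr rfl fun i _ => ?_
      simp [Equiv.arrowCongr, Fin.rev_castSucc, Fin.rev_succ]
  · change F _ = F _
    congr 1
    funext i
    simp only [extendTrajectory, Equiv.arrowCongr, Equiv.coe_fn_mk, Function.comp, Equiv.refl_apply]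
    congr 1
    ext
    simp [Fin.revPerm, Fin.val_rev]
    omega

end Expectation

/-! ### A fourth moment maximal inequality -/

section Martingale

variable {S : Type*}

/-- The additive functional `∑_{i < k} m (x i) (x (i + 1))` of a trajectory. -/
def pathSum (m : S → S → ℝ) (k : ℕ) (x : ℕ → S) : ℝ := ∑ i ∈ Finset.range k, m (x i) (x (i + 1))

/-- The sum `∑_{i < k} I i * m (x i) (x (i + 1))` with weights `I i` depending on the past. -/
def weightedPathSum (I : ℕ → (ℕ → S) → ℝ) (m : S → S → ℝ) (k : ℕ) (x : ℕ → S) : ℝ :=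
  ∑ i ∈ Finset.range k, I i x * m (x i) (x (i + 1))

theorem pathSum_succ (m : S → S → ℝ) (k : ℕ) (x : ℕ → S) :
    pathSum m (k + 1) x = pathSum m k x + m (x k) (x (k + 1)) := Finset.sum_range_succ _ _

theorem weightedPathSum_succ (I : ℕ → (ℕ → S) → ℝ) (m : S → S → ℝ) (k : ℕ) (x : ℕ → S) :
    weightedPathSum I m (k + 1) x = weightedPathSum I m k x + I k x * m (x k) (x (k + 1)) :=
  Finset.sum_range_succ _ _

theorem dependsOn_pathSum (m : S → S → ℝ) (k : ℕ) : DependsOn (pathSum m k) (Set.Iic k) := by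
  intro x x' hx
  refine Finset.sum_congr rfl fun i hi => ?_
  have hi := Finset.mem_range.1 hi
  rw [hx i (Set.mem_Iic.2 hi.le), hx (i + 1) (Set.mem_Iic.2 hi)]

theorem dependsOn_weightedPathSum {I : ℕ → (ℕ → S) → ℝ} (hI : ∀ i, DependsOn (I i) (Set.Iic i))
    (m : S → S → ℝ) (k : ℕ) : DependsOn (weightedPathSum I m k) (Set.Iic k) := by
  intro x x' hx
  refine Finset.sum_congr rfl fun i hi => ?_
  have hi := Finset.mem_range.1 hi
  rw [hx i (Set.mem_Iic.2 hi.le), hx (i + 1) (Set.mem_Iic.2 hi),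
    hI i fun j hj => hx j (Set.mem_Iic.2 (le_trans (Set.mem_Iic.1 hj) hi.le))]

variable [Fintype S] {P : Matrix S S ℝ} {π : S → ℝ}

local notation "𝔼" => trajectoryExpectation P π

/-- For a stopped martingale with bracket bounded by `Q`, the process `M⁴ - 8 M² Q` grows on
average by at most three times the fourth moment of the increments. -/
theorem IsReversibleChain.fourth_moment (h : IsReversibleChain P π) {m : S → S → ℝ} {q : S → ℝ}
    (hm : ∀ s, ∑ t, P s t * m s t = 0) (hq : ∀ s, ∑ t, P s t * m s t ^ 2 ≤ q s)
    {I : ℕ → (ℕ → S) → ℝ} (hI : ∀ i, DependsOn (I i) (Set.Iic i))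
    (hI01 : ∀ i x, I i x = 0 ∨ I i x = 1) (n : ℕ) :
    𝔼 n (fun x => weightedPathSum I m n x ^ 4) ≤
      6 * n * (∑ s, π s * ∑ t, P s t * m s t ^ 4) +
        64 * 𝔼 n (fun x => weightedPathSum I (fun s _ => q s) n x ^ 2) := by
  set M := weightedPathSum I m with hMdef
  set Q := weightedPathSum I (fun s _ => q s) with hQdef
  set μ := ∑ s, π s * ∑ t, P s t * m s t ^ 4 with hμ
  have hq0 : ∀ s, 0 ≤ q s := fun s =>
    (Finset.sum_nonneg fun t _ => mul_nonneg (h.nonneg s t) (sq_nonneg _)).trans (hq s)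
  have hMd : ∀ k, DependsOn (M k) (Set.Iic k) := dependsOn_weightedPathSum hI m
  have hQd : ∀ k, DependsOn (Q k) (Set.Iic k) := dependsOn_weightedPathSum hI _
  have hI0 : ∀ i x, 0 ≤ I i x := fun i x => by
    rcases hI01 i x with h | h <;> simp [h]
  have hQ0 : ∀ k x, 0 ≤ Q k x := fun k x =>
    Finset.sum_nonneg fun i _ => mul_nonneg (hI0 i x) (hq0 _)
  have step : ∀ k ≤ n, 𝔼 n (fun x => M k x ^ 4 - 8 * (M k x ^ 2 * Q k x)) ≤ 3 * k * μ := by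
    intro k
    induction k with
    | zero =>
      intro _
      simp [hMdef, weightedPathSum, trajectoryExpectation]
    | succ k ih =>
      intro hk
      have hk' : k < n := hk
      -- the terms of first order in `m` have mean zero, and `8 * M ^ 2 * (m ^ 2 - q)` has
      -- nonpositive mean
      have pt : ∀ x, M (k + 1) x ^ 4 - 8 * (M (k + 1) x ^ 2 * Q (k + 1) x) ≤
          ((M k x ^ 4 - 8 * (M k x ^ 2 * Q k x)) +
          (I k x * (4 * M k x ^ 3 - 16 * M k x * (Q k x + I k x * q (x k)))) *
            m (x k) (x (k + 1))) +
          ((8 * (I k x * M k x ^ 2)) * (m (x k) (x (k + 1)) ^ 2 - q (x k)) +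
          3 * m (x k) (x (k + 1)) ^ 4) := by
        intro x
        rw [hMdef, hQdef, weightedPathSum_succ, weightedPathSum_succ, ← hMdef, ← hQdef]
        have hQk := hQ0 k x
        have hqk := hq0 (x k)
        generalize M k x = a at *
        generalize Q k x = b at *
        generalize m (x k) (x (k + 1)) = z at *
        generalize q (x k) = c at *
        rcases hI01 k x with h | h <;> rw [h]
        · have : 0 ≤ z ^ 4 := by positivity
          nlinarith
        · have h1 : 0 ≤ z ^ 2 * (b + c) := by positivity
          have h2 : 0 ≤ z ^ 2 * (a - z) ^ 2 := by positivity
          nlinarith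
      have e1 : 𝔼 n (fun x => (I k x * (4 * M k x ^ 3 - 16 * M k x * (Q k x + I k x * q (x k)))) *
            m (x k) (x (k + 1))) = 0 := by
        rw [h.markov hk' (fun x x' hx => by
          simp only [hI k hx, hMd k hx, hQd k hx, hx k (Set.mem_Iic.2 le_rfl)]) m]
        simp [hm, trajectoryExpectation]
      have e2 : 𝔼 n (fun x => (8 * (I k x * M k x ^ 2)) * (m (x k) (x (k + 1)) ^ 2 - q (x k)))
          ≤ 0 := by
        rw [h.markov hk' (fun x x' hx => by simp only [hI k hx, hMd k hx])
          (fun s t => m s t ^ 2 - q s)]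
        have hz : 𝔼 n (fun _ => 0) = 0 := by simp [trajectoryExpectation]
        rw [← hz]
        refine h.expectation_mono n fun x => ?_
        refine mul_nonpos_of_nonneg_of_nonpos ?_ ?_
        · have := hI0 k x
          positivity
        · simp only [mul_sub, Finset.sum_sub_distrib, ← Finset.sum_mul, h.row_sum, one_mul]
          exact sub_nonpos.2 (hq _)
      have e3 : 𝔼 n (fun x => 3 * m (x k) (x (k + 1)) ^ 4) = 3 * μ := by
        rw [trajectoryExpectation_mul, h.stationary_pair hk' fun s t => m s t ^ 4]
      have := h.expectation_mono n pt
      rw [trajectoryExpectation_add, trajectoryExpectation_add, trajectoryExpectation_add] at this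
      have ih' := ih hk'.le
      push_cast
      linarith
  have fin := step n le_rfl
  have pt : ∀ x, M n x ^ 4 ≤ 2 * (M n x ^ 4 - 8 * (M n x ^ 2 * Q n x)) + 64 * Q n x ^ 2 := by
    intro x
    nlinarith [sq_nonneg (M n x ^ 2 - 8 * Q n x)]
  have := h.expectation_mono n pt
  rw [trajectoryExpectation_add, trajectoryExpectation_mul, trajectoryExpectation_mul] at this
  linarith

open Classical in
/-- The maximal inequality behind the comparison of scales: if `M` has increments
`m (x i) (x (i + 1))` of mean zero and conditional variance at most `q (x i)`, then the probability
that `|M|` reaches `η` is controlled by the bracket `Q` on the scale `η ^ 2`, and by the fourth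
moments of the increments. -/
theorem IsReversibleChain.maximal_inequality (h : IsReversibleChain P π) {m : S → S → ℝ}
    {q : S → ℝ} (hm : ∀ s, ∑ t, P s t * m s t = 0) (hq : ∀ s, ∑ t, P s t * m s t ^ 2 ≤ q s)
    {η : ℝ} (hη : 0 < η) (n : ℕ) :
    𝔼 n (fun x => if ∃ k ≤ n, η ≤ |pathSum m k x| then 1 else 0) ≤
      65 * 𝔼 n (fun x => min 1 ((pathSum (fun s _ => q s) n x / η ^ 2) ^ 2)) +
        6 * n * (∑ s, π s * ∑ t, P s t * m s t ^ 4) / η ^ 4 := by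
  set M := pathSum m with hM
  set Q := pathSum (fun s (_ : S) => q s) with hQ
  have hq0 : ∀ s, 0 ≤ q s := fun s =>
    (Finset.sum_nonneg fun t _ => mul_nonneg (h.nonneg s t) (sq_nonneg _)).trans (hq s)
  have hQmono : ∀ x, Monotone fun k => Q k x := fun x => monotone_nat_of_le_succ fun k => by
    simp only [hQ, pathSum_succ]
    linarith [hq0 (x k)]
  have hQ0 : ∀ k x, 0 ≤ Q k x := fun k x => Finset.sum_nonneg fun i _ => hq0 _
  -- stop before the bracket exceeds `η ^ 2`, and as soon as `|M|` reaches `η`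
  set I : ℕ → (ℕ → S) → ℝ := fun i x =>
    if Q (i + 1) x ≤ η ^ 2 ∧ ∀ j ≤ i, |M j x| < η then 1 else 0 with hIdef
  have hI01 : ∀ i x, I i x = 0 ∨ I i x = 1 := fun i x => by
    simp only [hIdef]; split_ifs <;> simp
  have hI : ∀ i, DependsOn (I i) (Set.Iic i) := by
    intro i x x' hx
    have e1 : Q (i + 1) x = Q (i + 1) x' := Finset.sum_congr rfl fun j hj => by
      rw [hx j (Set.mem_Iic.2 (Nat.lt_succ_iff.1 (Finset.mem_range.1 hj)))]
    have e2 : ∀ j ≤ i, M j x = M j x' := fun j hj =>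
      dependsOn_pathSum m j fun k hk => hx k (le_trans (Set.mem_Iic.1 hk) hj)
    have e3 : (∀ j ≤ i, |M j x| < η) ↔ ∀ j ≤ i, |M j x'| < η :=
      forall₂_congr fun j hj => by rw [e2 j hj]
    simp only [hIdef, e1, e3]
  have hQhat : ∀ k x, 0 ≤ weightedPathSum I (fun s _ => q s) k x ∧
      weightedPathSum I (fun s _ => q s) k x ≤ Q k x ∧
      weightedPathSum I (fun s _ => q s) k x ≤ η ^ 2 := by
    intro k x
    induction k with
    | zero => simp [weightedPathSum, hQ, pathSum]; positivity
    | succ k ih =>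
      rw [weightedPathSum_succ]
      have e : Q (k + 1) x = Q k x + q (x k) := pathSum_succ _ _ _
      have := hq0 (x k)
      rcases hI01 k x with h0 | h1
      · rw [h0]
        exact ⟨by linarith, by linarith, by linarith⟩
      · rw [h1]
        have hle : Q (k + 1) x ≤ η ^ 2 := by
          simp only [hIdef] at h1
          by_contra hcon
          rw [if_neg (fun h => hcon h.1)] at h1
          exact zero_ne_one h1
        exact ⟨by linarith, by linarith, by linarith⟩
  -- if the bracket stays below `η ^ 2`, the stopped martingale stays where `|M|` reached `η`
  have hreach : ∀ x, Q n x ≤ η ^ 2 → (∃ k ≤ n, η ≤ |M k x|) →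
      η ^ 4 ≤ weightedPathSum I m n x ^ 4 := by
    intro x hQn hex
    have hτ := Nat.find_spec hex
    have hmin := fun j hj => Nat.find_min hex (m := j) hj
    set τ := Nat.find hex
    have h1 : ∀ k ≤ τ, weightedPathSum I m k x = M k x := by
      intro k
      induction k with
      | zero => intro _; simp [weightedPathSum, hM, pathSum]
      | succ k ih =>
        intro hk
        have : I k x = 1 := if_pos ⟨(hQmono x (hk.trans hτ.1)).trans hQn, fun j hj => by
          have := hmin j (by omega)
          push Not at this
          exact this (by omega)⟩
        rw [weightedPathSum_succ, ih (by omega), this, one_mul, hM, pathSum_succ]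
    have h2 : ∀ k, τ ≤ k → weightedPathSum I m k x = M τ x := by
      intro k hk
      induction k, hk using Nat.le_induction with
      | base => exact h1 τ le_rfl
      | succ k hk ih =>
        have : I k x = 0 := if_neg fun hcon => (hcon.2 τ hk).not_ge hτ.2
        rw [weightedPathSum_succ, ih, this, zero_mul, add_zero]
    rw [h2 n hτ.1, ← Even.pow_abs (n := 4) (by decide) (M τ x)]
    exact pow_le_pow_left₀ hη.le hτ.2 4
  have hη4 : 0 < η ^ 4 := by positivity
  have hη2 : 0 < η ^ 2 := by positivity
  have pt : ∀ x, η ^ 4 * (if ∃ k ≤ n, η ≤ |M k x| then (1 : ℝ) else 0) +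
      64 * weightedPathSum I (fun s _ => q s) n x ^ 2 ≤
      65 * η ^ 4 * min 1 ((Q n x / η ^ 2) ^ 2) + weightedPathSum I m n x ^ 4 := by
    intro x
    obtain ⟨g0, g1, g2⟩ := hQhat n x
    have hM4 : 0 ≤ weightedPathSum I m n x ^ 4 := by positivity
    have e4 : η ^ 4 = η ^ 2 * η ^ 2 := by ring
    have eQ : η ^ 4 * (Q n x / η ^ 2) ^ 2 = Q n x ^ 2 := by field_simp
    rcases le_or_gt (Q n x) (η ^ 2) with hc | hc
    · have hmin : min 1 ((Q n x / η ^ 2) ^ 2) = (Q n x / η ^ 2) ^ 2 :=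
        min_eq_right (pow_le_one₀ (div_nonneg (hQ0 n x) hη2.le) ((div_le_one hη2).2 hc))
      rw [hmin, mul_assoc, eQ]
      have : η ^ 4 * (if ∃ k ≤ n, η ≤ |M k x| then (1 : ℝ) else 0) ≤
          weightedPathSum I m n x ^ 4 := by
        split_ifs with hex
        · rw [mul_one]; exact hreach x hc hex
        · rw [mul_zero]; exact hM4
      nlinarith
    · have hmin : min 1 ((Q n x / η ^ 2) ^ 2) = 1 :=
        min_eq_left (one_le_pow₀ ((one_le_div hη2).2 hc.le))
      rw [hmin]
      have : η ^ 4 * (if ∃ k ≤ n, η ≤ |M k x| then (1 : ℝ) else 0) ≤ η ^ 4 := by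
        split_ifs <;> linarith
      nlinarith
  have e := h.expectation_mono n pt
  rw [trajectoryExpectation_add, trajectoryExpectation_add, trajectoryExpectation_mul,
    trajectoryExpectation_mul, trajectoryExpectation_mul] at e
  have f := h.fourth_moment hm hq hI hI01 n
  rw [← sub_le_iff_le_add', le_div_iff₀ hη4]
  linarith

end Martingale

/-! ### Oscillation of a truncated Lipschitz function along the chain -/

section Oscillation

variable {S : Type*} [Fintype S] {P : Matrix S S ℝ} {π : S → ℝ}

local notation "𝔼" => trajectoryExpectation P π

open Classical in
/-- If `f` is `1`-Lipschitz for the truncated distance `min d lam`, then `f (x k) - f (x 0)` is,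
up to two boundary terms, half the difference of a martingale for the chain and one for its time
reversal, and the maximal inequality applies to both. -/
theorem IsReversibleChain.oscillation (h : IsReversibleChain P π) {d : S → S → ℝ}
    {f : S → ℝ} {lam : ℝ} (hlam : 0 < lam) (hf : ∀ s t, |f s - f t| ≤ min (d s t) lam)
    {n : ℕ} (hn : 1 ≤ n) :
    𝔼 n (fun x => if ∃ k ≤ n, lam ≤ |f (x 0) - f (x k)| then 1 else 0) ≤
      130 * 𝔼 n (fun x => min 1 ((4 * pathSum (fun s _ => ∑ t, P s t * d s t ^ 2) n x /
        lam ^ 2) ^ 2)) +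
      3584 * n * ∑ s, π s * ∑ t, P s t * min 1 ((d s t ^ 2 / lam ^ 2) ^ 2) := by
  set Pf : S → ℝ := fun s => ∑ t, P s t * f t with hPf
  set m : S → S → ℝ := fun s t => f t - Pf s with hmdef
  set q : S → ℝ := fun s => ∑ t, P s t * d s t ^ 2 with hqdef
  set ν := ∑ s, π s * ∑ t, P s t * min 1 ((d s t ^ 2 / lam ^ 2) ^ 2) with hν
  have hd0 : ∀ s t, 0 ≤ d s t := fun s t =>
    (abs_nonneg _).trans ((hf s t).trans (min_le_left _ _))
  have hmean : ∀ s, ∑ t, P s t * (f t - f s) = Pf s - f s := fun s => by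
    simp only [mul_sub, Finset.sum_sub_distrib, ← Finset.sum_mul, h.row_sum, one_mul, hPf]
  have hm0 : ∀ s, ∑ t, P s t * m s t = 0 := fun s => by
    simp only [hmdef, mul_sub, Finset.sum_sub_distrib, ← Finset.sum_mul, h.row_sum, one_mul, hPf,
      sub_self]
  -- the conditional variance of `f` is at most the mean square displacement
  have hmq : ∀ s, ∑ t, P s t * m s t ^ 2 ≤ q s := fun s => by
    have e : ∑ t, P s t * m s t ^ 2 = ∑ t, P s t * (f t - f s) ^ 2 - (Pf s - f s) ^ 2 := by
      have : ∀ t, P s t * m s t ^ 2 = P s t * (f t - f s) ^ 2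
          - (Pf s - f s) * (2 * (P s t * (f t - f s))) + P s t * (Pf s - f s) ^ 2 := fun t => by
        simp only [hmdef]; ring
      simp only [this, Finset.sum_add_distrib, Finset.sum_sub_distrib, ← Finset.mul_sum,
        ← Finset.sum_mul, hmean, h.row_sum]
      ring
    rw [e]
    have : ∑ t, P s t * (f t - f s) ^ 2 ≤ q s := Finset.sum_le_sum fun t _ => by
      refine mul_le_mul_of_nonneg_left ?_ (h.nonneg s t)
      rw [← sq_abs, abs_sub_comm]
      exact pow_le_pow_left₀ (abs_nonneg _) ((hf s t).trans (min_le_left _ _)) 2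
    nlinarith [sq_nonneg (Pf s - f s)]
  have hlam4 : 0 < lam ^ 4 := by positivity
  have hmin : ∀ s t, (f t - f s) ^ 4 ≤ lam ^ 4 * min 1 ((d s t ^ 2 / lam ^ 2) ^ 2) := by
    intro s t
    have h1 : (f t - f s) ^ 4 ≤ (min (d s t) lam) ^ 4 := by
      rw [← Even.pow_abs (by decide : Even 4), abs_sub_comm]
      exact pow_le_pow_left₀ (abs_nonneg _) (hf s t) 4
    have h0 : 0 ≤ min (d s t) lam := le_min (hd0 s t) hlam.le
    refine h1.trans ?_
    rw [mul_min_of_nonneg _ _ hlam4.le, mul_one]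
    refine le_min (pow_le_pow_left₀ h0 (min_le_right _ _) 4) ?_
    have : lam ^ 4 * (d s t ^ 2 / lam ^ 2) ^ 2 = d s t ^ 4 := by field_simp
    rw [this]
    exact pow_le_pow_left₀ h0 (min_le_left _ _) 4
  have hf4 : ∀ s, ∑ t, P s t * (f t - f s) ^ 4 ≤
      lam ^ 4 * ∑ t, P s t * min 1 ((d s t ^ 2 / lam ^ 2) ^ 2) := fun s => by
    rw [Finset.mul_sum]
    refine Finset.sum_le_sum fun t _ => ?_
    have := mul_le_mul_of_nonneg_left (hmin s t) (h.nonneg s t)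
    linarith
  have hjensen : ∀ s, (Pf s - f s) ^ 4 ≤ ∑ t, P s t * (f t - f s) ^ 4 := fun s => by
    rw [← hmean]
    exact Real.pow_arith_mean_le_arith_mean_pow_of_even _ _ _ (fun t _ => h.nonneg s t)
      (h.row_sum s) (by decide)
  have hm4 : ∑ s, π s * ∑ t, P s t * m s t ^ 4 ≤ 16 * (lam ^ 4 * ν) := by
    rw [hν, Finset.mul_sum, Finset.mul_sum]
    refine Finset.sum_le_sum fun s _ => ?_
    have e : ∑ t, P s t * m s t ^ 4 ≤ 16 * ∑ t, P s t * (f t - f s) ^ 4 := by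
      have pt : ∀ t, P s t * m s t ^ 4 ≤
          8 * (P s t * (f t - f s) ^ 4) + P s t * (8 * (Pf s - f s) ^ 4) := fun t => by
        have : m s t ^ 4 ≤ 8 * (f t - f s) ^ 4 + 8 * (Pf s - f s) ^ 4 := by
          have e : m s t = (f t - f s) - (Pf s - f s) := by simp only [hmdef]; ring
          rw [e]
          generalize f t - f s = a
          generalize Pf s - f s = b
          nlinarith [sq_nonneg (a ^ 2 - b ^ 2), sq_nonneg (a + b), sq_nonneg ((a + b) ^ 2),
            mul_nonneg (sq_nonneg (a + b)) (sq_nonneg (a - b)), sq_nonneg (a - b),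
            mul_nonneg (sq_nonneg (a + b)) (sq_nonneg a),
            mul_nonneg (sq_nonneg (a + b)) (sq_nonneg b)]
        have := mul_le_mul_of_nonneg_left this (h.nonneg s t)
        linarith
      have := Finset.sum_le_sum fun t (_ : t ∈ Finset.univ) => pt t
      rw [Finset.sum_add_distrib, ← Finset.mul_sum, ← Finset.sum_mul, h.row_sum] at this
      linarith [hjensen s]
    have := mul_le_mul_of_nonneg_left (e.trans (mul_le_mul_of_nonneg_left (hf4 s)
      (by norm_num : (0 : ℝ) ≤ 16))) (h.init_nonneg s)
    linarith
  -- the event that the martingale reaches `lam / 2`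
  set U : (ℕ → S) → ℝ := fun x => if ∃ k ≤ n, lam / 2 ≤ |pathSum m k x| then 1 else 0 with hU
  have hU0 : ∀ x, 0 ≤ U x := fun x => by simp only [hU]; split_ifs <;> norm_num
  have hUle := h.maximal_inequality hm0 hmq (half_pos hlam) n
  have hn0 : (0 : ℝ) ≤ n := Nat.cast_nonneg n
  have hU' : 𝔼 n U ≤ 65 * 𝔼 n (fun x => min 1 ((4 * pathSum (fun s _ => q s) n x /
        lam ^ 2) ^ 2)) + 1536 * n * ν := by
    have e1 : ∀ x : ℕ → S, pathSum (fun s _ => q s) n x / (lam / 2) ^ 2 =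
        4 * pathSum (fun s _ => q s) n x / lam ^ 2 := fun x => by field_simp; norm_num
    simp only [e1] at hUle
    refine hUle.trans (add_le_add_right ?_ _)
    rw [div_le_iff₀ (by positivity)]
    have := mul_le_mul_of_nonneg_left hm4 (by positivity : (0 : ℝ) ≤ 6 * n)
    calc _ ≤ _ := this
      _ = _ := by ring
  have hbd : ∀ k ≤ n, 𝔼 n (fun x => (Pf (x k) - f (x k)) ^ 4) ≤ lam ^ 4 * ν := fun k hk => by
    rw [h.stationary hk fun s => (Pf s - f s) ^ 4, hν, Finset.mul_sum]
    refine Finset.sum_le_sum fun s _ => ?_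
    have := mul_le_mul_of_nonneg_left ((hjensen s).trans (hf4 s)) (h.init_nonneg s)
    linarith
  have hrev := h.reversal n U
  have pt : ∀ x, (if ∃ k ≤ n, lam ≤ |f (x 0) - f (x k)| then (1 : ℝ) else 0) ≤
      (U x + U fun i => x (n - i)) +
        256 / lam ^ 4 * ∑ k ∈ Finset.range (n + 1), (Pf (x k) - f (x k)) ^ 4 := by
    intro x
    have hs0 : ∀ k ∈ Finset.range (n + 1), 0 ≤ (Pf (x k) - f (x k)) ^ 4 := fun k _ => by
      positivity
    have hs := Finset.sum_nonneg hs0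
    have hs' := mul_nonneg (by positivity : 0 ≤ 256 / lam ^ 4) hs
    split_ifs with hex
    swap
    · have := hU0 x
      have := hU0 fun i => x (n - i)
      linarith
    obtain ⟨k, hk, hlk⟩ := hex
    by_cases hbig : ∃ j ≤ n, lam / 4 ≤ |Pf (x j) - f (x j)|
    · obtain ⟨j, hj, hjl⟩ := hbig
      have h1 := Finset.single_le_sum hs0 (Finset.mem_range.2 (Nat.lt_succ_of_le hj))
      have h2 : (lam / 4) ^ 4 ≤ (Pf (x j) - f (x j)) ^ 4 := by
        rw [← Even.pow_abs (by decide : Even 4) (Pf (x j) - f (x j))]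
        exact pow_le_pow_left₀ (by positivity) hjl 4
      have h3 : 1 = 256 / lam ^ 4 * (lam / 4) ^ 4 := by field_simp; norm_num
      have h4 := mul_le_mul_of_nonneg_left (h2.trans h1) (by positivity : 0 ≤ 256 / lam ^ 4)
      have := hU0 x
      have := hU0 fun i => x (n - i)
      linarith
    push Not at hbig
    -- the backward martingale, expressed through the forward one of the reversed trajectory
    have hN : pathSum (fun s t => m t s) k x =
        pathSum m n (fun i => x (n - i)) - pathSum m (n - k) (fun i => x (n - i)) := by
      obtain ⟨l, rfl⟩ := Nat.exists_eq_add_of_le' hk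
      unfold pathSum
      rw [Nat.add_sub_cancel, Finset.sum_range_add, add_sub_cancel_left,
        ← Finset.sum_range_reflect]
      refine Finset.sum_congr rfl fun i hi => ?_
      have hi := Finset.mem_range.1 hi
      congr 2 <;> omega
    have htel : ∀ k, pathSum m k x - pathSum (fun s t => m t s) k x =
        (f (x k) + Pf (x k)) - (f (x 0) + Pf (x 0)) := by
      intro k
      induction k with
      | zero => simp [pathSum]
      | succ k ih =>
        rw [pathSum_succ, pathSum_succ]
        simp only [hmdef] at ih ⊢
        linarith
    have hone : ∀ y : ℕ → S, (∃ j ≤ n, lam / 2 ≤ |pathSum m j y|) → U y = 1 := fun y hy =>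
      if_pos hy
    by_cases hfw : ∃ j ≤ n, lam / 2 ≤ |pathSum m j x|
    · have := hU0 fun i => x (n - i)
      rw [hone x hfw]
      linarith
    by_cases hbw : ∃ j ≤ n, lam / 2 ≤ |pathSum m j fun i => x (n - i)|
    · have := hU0 x
      rw [hone _ hbw]
      linarith
    exfalso
    push Not at hfw hbw
    have a1 := abs_lt.1 (hfw k hk)
    have a2 := abs_lt.1 (hbw n le_rfl)
    have a3 := abs_lt.1 (hbw (n - k) (Nat.sub_le _ _))
    have a4 := abs_lt.1 (hbig k hk)
    have a5 := abs_lt.1 (hbig 0 (Nat.zero_le _))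
    have a6 := htel k
    rw [hN] at a6
    rcases le_abs.1 hlk with a7 | a7 <;> linarith
  have e := h.expectation_mono n pt
  rw [trajectoryExpectation_add, trajectoryExpectation_add, trajectoryExpectation_mul,
    trajectoryExpectation_sum, hrev] at e
  have e2 : 256 / lam ^ 4 * ∑ k ∈ Finset.range (n + 1), 𝔼 n (fun x => (Pf (x k) - f (x k)) ^ 4) ≤
      512 * n * ν := by
    have hν0 : 0 ≤ ν := Finset.sum_nonneg fun s _ => mul_nonneg (h.init_nonneg s)
      (Finset.sum_nonneg fun t _ => mul_nonneg (h.nonneg s t) (by positivity))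
    have h1 := Finset.sum_le_sum fun k (hk : k ∈ Finset.range (n + 1)) =>
      hbd k (Nat.lt_succ_iff.1 (Finset.mem_range.1 hk))
    rw [Finset.sum_const, Finset.card_range, nsmul_eq_mul] at h1
    have h2 := mul_le_mul_of_nonneg_left h1 (by positivity : 0 ≤ 256 / lam ^ 4)
    have h3 : 256 / lam ^ 4 * (((n + 1 : ℕ) : ℝ) * (lam ^ 4 * ν)) = 256 * (n + 1) * ν := by
      push_cast; field_simp
    rw [h3] at h2
    have : (1 : ℝ) ≤ n := by exact_mod_cast hn
    nlinarith
  linarith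

end Oscillation

/-! ### Summation over scales -/

theorem min_le_telescoping {a b : ℝ} (ha : 0 < a) (hb : 0 < b) :
    b * min 1 ((a / b) ^ 2) ≤
      10 / 3 * (a * (4 * b) / (a + 4 * b) - a * b / (a + b)) := by
  have e : 10 / 3 * (a * (4 * b) / (a + 4 * b) - a * b / (a + b)) =
      10 * a ^ 2 * b / ((a + 4 * b) * (a + b)) := by
    field_simp; ring
  rw [e, le_div_iff₀ (by positivity)]
  rcases le_total b a with hab | hab
  · have : b * min 1 ((a / b) ^ 2) ≤ b := mul_le_of_le_one_right hb.le (min_le_left _ _)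
    have h1 : (a + 4 * b) * (a + b) ≤ 10 * a ^ 2 := by nlinarith
    have h2 : 0 ≤ (a + 4 * b) * (a + b) := by positivity
    nlinarith
  · have : b * min 1 ((a / b) ^ 2) ≤ a ^ 2 / b := by
      refine (mul_le_mul_of_nonneg_left (min_le_right _ _) hb.le).trans (le_of_eq ?_)
      field_simp
    have h1 : (a + 4 * b) * (a + b) ≤ 10 * b ^ 2 := by nlinarith
    have h2 : 0 ≤ (a + 4 * b) * (a + b) := by positivity
    calc b * min 1 ((a / b) ^ 2) * ((a + 4 * b) * (a + b))
        ≤ a ^ 2 / b * (10 * b ^ 2) := mul_le_mul this h1 h2 (by positivity)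
      _ = 10 * a ^ 2 * b := by field_simp

/-- Each scale contributes `min (b, a ^ 2 / b)`, so the sum over the geometric sequence
`b = c * 4 ^ k` of scales is comparable to `a`. -/
theorem sum_scales_le {a c : ℝ} (ha : 0 ≤ a) (hc : 0 < c) (K : ℕ) :
    ∑ k ∈ Finset.range K, c * 4 ^ k * min 1 ((a / (c * 4 ^ k)) ^ 2) ≤ 4 * a := by
  rcases ha.eq_or_lt with rfl | ha
  · simp
  have hb : ∀ k : ℕ, 0 < c * 4 ^ k := fun k => by positivity
  have key : ∑ k ∈ Finset.range K, c * 4 ^ k * min 1 ((a / (c * 4 ^ k)) ^ 2) ≤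
      10 / 3 * (a * (c * 4 ^ K) / (a + c * 4 ^ K) - a * c / (a + c)) := by
    induction K with
    | zero => simp
    | succ K ih =>
      rw [Finset.sum_range_succ]
      have := min_le_telescoping ha (hb K)
      have e : c * 4 ^ (K + 1) = 4 * (c * 4 ^ K) := by ring
      rw [e]
      linarith
  have h1 : a * (c * 4 ^ K) / (a + c * 4 ^ K) ≤ a := by
    rw [div_le_iff₀ (by have := hb K; positivity)]
    nlinarith [hb K]
  have h2 : 0 ≤ a * c / (a + c) := by positivity
  linarith

open Classical in
/-- Decomposition of a square into dyadic scales. -/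
theorem sq_le_sum_scales {D ε : ℝ} (hD : 0 ≤ D) (hε : 0 < ε) {K : ℕ} (hK : D < ε * 2 ^ K) :
    D ^ 2 ≤ ε ^ 2 + 4 * ∑ k ∈ Finset.range K,
      ε ^ 2 * 4 ^ k * if ε * 2 ^ k ≤ D then (1 : ℝ) else 0 := by
  induction K with
  | zero =>
    simp only [pow_zero, mul_one] at hK
    simp only [Finset.range_zero, Finset.sum_empty, mul_zero, add_zero]
    exact pow_le_pow_left₀ hD hK.le 2
  | succ K ih =>
    rw [Finset.sum_range_succ]
    rcases lt_or_ge D (ε * 2 ^ K) with h | h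
    · have := ih h
      have : 0 ≤ ε ^ 2 * 4 ^ K * if ε * 2 ^ K ≤ D then (1 : ℝ) else 0 := by
        split_ifs <;> positivity
      linarith
    · rw [if_pos h]
      have h0 : 0 ≤ ∑ k ∈ Finset.range K, ε ^ 2 * 4 ^ k * if ε * 2 ^ k ≤ D then (1 : ℝ) else 0 :=
        Finset.sum_nonneg fun k _ => by split_ifs <;> positivity
      have h1 := pow_le_pow_left₀ hD hK.le 2
      have e : (ε * 2 ^ (K + 1)) ^ 2 = 4 * (ε ^ 2 * 4 ^ K) := by
        rw [mul_pow, ← pow_mul, pow_mul', pow_succ]; norm_num; ring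
      have : 0 ≤ ε ^ 2 := by positivity
      linarith

/-- A family of threshold maps: for each scale `τ` there are finitely many functions which are
`1`-Lipschitz and of oscillation at most `τ / L`, and such that any two points at distance at least
`τ` are separated by `τ / L` by at least an eighth of them. -/
def HasThresholdMaps {S : Type*} (d : S → S → ℝ) (L : ℝ) : Prop :=
  ∀ τ : ℝ, 0 < τ → ∃ (ι : Type) (_ : Fintype ι) (_ : Nonempty ι) (f : ι → S → ℝ),
    (∀ i s t, |f i s - f i t| ≤ min (d s t) (τ / L)) ∧
    ∀ s t, τ ≤ d s t → Fintype.card ι ≤ 8 * Nat.card {i // τ / L ≤ |f i s - f i t|}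

theorem pathSum_nonneg {S : Type*} {q : S → ℝ} (hq : ∀ s, 0 ≤ q s) (n : ℕ) (x : ℕ → S) :
    0 ≤ pathSum (fun s _ => q s) n x := Finset.sum_nonneg fun _ _ => hq _

section Scales

variable {S : Type*} [Fintype S] {P : Matrix S S ℝ} {π : S → ℝ}

local notation "𝔼" => trajectoryExpectation P π

/-- The contribution of one scale: threshold maps bound the probability that the displacement
reaches `τ`. -/
theorem IsReversibleChain.displacement_tail (h : IsReversibleChain P π) {d : S → S → ℝ} {L : ℝ}
    (hL : 0 < L) (hd : HasThresholdMaps d L) {n : ℕ} (hn : 1 ≤ n) (T : (ℕ → S) → ℕ)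
    (hT : ∀ x, T x ≤ n) {τ : ℝ} (hτ : 0 < τ) [∀ x : ℕ → S, Decidable (τ ≤ d (x 0) (x (T x)))] :
    𝔼 n (fun x => if τ ≤ d (x 0) (x (T x)) then 1 else 0) ≤
      8 * (130 * 𝔼 n (fun x => min 1 ((4 * L ^ 2 *
          pathSum (fun s _ => ∑ t, P s t * d s t ^ 2) n x / τ ^ 2) ^ 2)) +
        3584 * n * ∑ s, π s * ∑ t, P s t * min 1 ((L ^ 2 * d s t ^ 2 / τ ^ 2) ^ 2)) := by
  classical
  obtain ⟨ι, _, _, f, hf, hsep⟩ := hd τ hτ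
  have hlam : 0 < τ / L := by positivity
  have hosc := fun i => h.oscillation hlam (hf i) hn
  set b := 130 * 𝔼 n (fun x => min 1 ((4 * L ^ 2 *
          pathSum (fun s _ => ∑ t, P s t * d s t ^ 2) n x / τ ^ 2) ^ 2)) +
        3584 * n * ∑ s, π s * ∑ t, P s t * min 1 ((L ^ 2 * d s t ^ 2 / τ ^ 2) ^ 2) with hb
  have e1 : ∀ a : ℝ, 4 * a / (τ / L) ^ 2 = 4 * L ^ 2 * a / τ ^ 2 := fun a => by
    field_simp
  have e2 : ∀ a : ℝ, a / (τ / L) ^ 2 = L ^ 2 * a / τ ^ 2 := fun a => by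
    field_simp
  simp only [e1] at hosc
  simp only [e2] at hosc
  have pt : ∀ x : ℕ → S, (Fintype.card ι : ℝ) * (if τ ≤ d (x 0) (x (T x)) then 1 else 0) ≤
      8 * ∑ i, if ∃ k ≤ n, τ / L ≤ |f i (x 0) - f i (x k)| then (1 : ℝ) else 0 := by
    intro x
    split_ifs with hx
    · have h1 : Fintype.card ι ≤ 8 * (Finset.univ.filter fun i =>
          τ / L ≤ |f i (x 0) - f i (x (T x))|).card := by
        have := hsep _ _ hx
        rwa [Nat.card_eq_fintype_card, Fintype.card_subtype] at this
      have h2 : ((Finset.univ.filter fun i =>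
          τ / L ≤ |f i (x 0) - f i (x (T x))|).card : ℝ) ≤
          ∑ i, if ∃ k ≤ n, τ / L ≤ |f i (x 0) - f i (x k)| then (1 : ℝ) else 0 := by
        rw [Finset.card_filter]
        push_cast
        refine Finset.sum_le_sum fun i _ => ?_
        by_cases hi : τ / L ≤ |f i (x 0) - f i (x (T x))|
        · rw [if_pos hi, if_pos ⟨T x, hT x, hi⟩]
        · rw [if_neg hi]
          split_ifs <;> norm_num
      have h3 : (Fintype.card ι : ℝ) ≤ 8 * ((Finset.univ.filter fun i =>
          τ / L ≤ |f i (x 0) - f i (x (T x))|).card : ℝ) := by exact_mod_cast h1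
      linarith
    · rw [mul_zero]
      exact mul_nonneg (by norm_num) (Finset.sum_nonneg fun i _ => by split_ifs <;> norm_num)
  have e := h.expectation_mono n pt
  rw [trajectoryExpectation_mul, trajectoryExpectation_mul, trajectoryExpectation_sum] at e
  have hsum := Finset.sum_le_sum fun i (_ : i ∈ Finset.univ) => hosc i
  rw [Finset.sum_const, Finset.card_univ, nsmul_eq_mul, ← hb] at hsum
  have hpos : (0 : ℝ) < Fintype.card ι := by exact_mod_cast Fintype.card_pos
  refine le_of_mul_le_mul_left ?_ hpos
  linarith

/-- Maximal Markov type `2` for finite chains in a space with threshold maps. The random time `T`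
is arbitrary; it will be the time of maximal displacement. -/
theorem IsReversibleChain.displacement_sq_le (h : IsReversibleChain P π) {d : S → S → ℝ} {L : ℝ}
    (hL : 0 < L) (hd0 : ∀ s t, 0 ≤ d s t) (hd : HasThresholdMaps d L) {n : ℕ} (hn : 1 ≤ n)
    (T : (ℕ → S) → ℕ) (hT : ∀ x, T x ≤ n) :
    𝔼 n (fun x => d (x 0) (x (T x)) ^ 2) ≤
      (725 * L) ^ 2 * n * ∑ s, π s * ∑ t, P s t * d s t ^ 2 := by
  classical
  set q : S → ℝ := fun s => ∑ t, P s t * d s t ^ 2 with hq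
  have hq0 : ∀ s, 0 ≤ q s := fun s =>
    Finset.sum_nonneg fun t _ => mul_nonneg (h.nonneg s t) (sq_nonneg _)
  set E := ∑ s, π s * q s with hE
  have hEQ : 𝔼 n (fun x => pathSum (fun s _ => q s) n x) = n * E := by
    unfold pathSum
    rw [trajectoryExpectation_sum, Finset.sum_congr rfl fun i hi =>
      h.stationary (Finset.mem_range.1 hi).le q]
    simp [hE]
  have hone : 𝔼 n (fun _ => (1 : ℝ)) = 1 := by
    rw [h.stationary (Nat.zero_le n) fun _ => 1]
    simpa using h.init_sum
  obtain ⟨B, hB⟩ : ∃ B, ∀ p : S × S, d p.1 p.2 ≤ B := by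
    obtain ⟨B, hB⟩ := Finite.exists_le fun p : S × S => d p.1 p.2
    exact ⟨B, hB⟩
  have main : ∀ ε : ℝ, 0 < ε → 𝔼 n (fun x => d (x 0) (x (T x)) ^ 2) ≤
      (725 * L) ^ 2 * n * E + ε ^ 2 := by
    intro ε hε
    obtain ⟨K, hK⟩ : ∃ K : ℕ, B < ε * 2 ^ K := by
      obtain ⟨K, hK⟩ := pow_unbounded_of_one_lt (B / ε) (one_lt_two (α := ℝ))
      exact ⟨K, by rwa [div_lt_iff₀' hε] at hK⟩
    have e := h.expectation_mono n fun x : ℕ → S =>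
      sq_le_sum_scales (hd0 (x 0) (x (T x))) hε ((hB (x 0, x (T x))).trans_lt hK)
    have hc : 𝔼 n (fun _ => ε ^ 2) = ε ^ 2 := by
      have := trajectoryExpectation_mul P π n (ε ^ 2) fun _ => 1
      rw [hone] at this
      simpa using this
    rw [trajectoryExpectation_add, hc, trajectoryExpectation_mul, trajectoryExpectation_sum] at e
    simp only [trajectoryExpectation_mul] at e
    have hpow : ∀ k : ℕ, (ε * 2 ^ k) ^ 2 = ε ^ 2 * 4 ^ k := fun k => by
      rw [mul_pow, ← pow_mul, pow_mul']; norm_num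
    have htail : ∀ k ∈ Finset.range K, ε ^ 2 * 4 ^ k *
        𝔼 n (fun x => if ε * 2 ^ k ≤ d (x 0) (x (T x)) then 1 else 0) ≤ _ := fun k _ =>
      mul_le_mul_of_nonneg_left (h.displacement_tail hL hd hn T hT (τ := ε * 2 ^ k) (by positivity))
        (by positivity : 0 ≤ ε ^ 2 * 4 ^ k)
    simp only [hpow] at htail
    have hsum := Finset.sum_le_sum htail
    have s1 : ∑ k ∈ Finset.range K, ε ^ 2 * 4 ^ k * 𝔼 n (fun x => min 1 ((4 * L ^ 2 *
          pathSum (fun s _ => ∑ t, P s t * d s t ^ 2) n x / (ε ^ 2 * 4 ^ k)) ^ 2)) ≤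
        4 * (4 * L ^ 2 * (n * E)) := by
      have pt := h.expectation_mono n fun x : ℕ → S =>
        sum_scales_le (a := 4 * L ^ 2 * pathSum (fun s _ => q s) n x) (c := ε ^ 2)
          (mul_nonneg (by positivity) (pathSum_nonneg hq0 n x)) (by positivity) K
      rw [trajectoryExpectation_sum, trajectoryExpectation_mul, trajectoryExpectation_mul,
        hEQ] at pt
      simpa only [trajectoryExpectation_mul] using pt
    have s2 : ∑ k ∈ Finset.range K, ε ^ 2 * 4 ^ k *
        ∑ s, π s * ∑ t, P s t * min 1 ((L ^ 2 * d s t ^ 2 / (ε ^ 2 * 4 ^ k)) ^ 2) ≤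
        4 * (L ^ 2 * E) := by
      have : ∀ s, π s * ∑ t, P s t * ∑ k ∈ Finset.range K,
          ε ^ 2 * 4 ^ k * min 1 ((L ^ 2 * d s t ^ 2 / (ε ^ 2 * 4 ^ k)) ^ 2) ≤
          π s * ∑ t, P s t * (4 * (L ^ 2 * d s t ^ 2)) := fun s =>
        mul_le_mul_of_nonneg_left (Finset.sum_le_sum fun t _ => mul_le_mul_of_nonneg_left
          (sum_scales_le (by positivity) (by positivity) K) (h.nonneg s t)) (h.init_nonneg s)
      have := Finset.sum_le_sum fun s (_ : s ∈ Finset.univ) => this s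
      have e3 : ∑ s, π s * ∑ t, P s t * (4 * (L ^ 2 * d s t ^ 2)) = 4 * (L ^ 2 * E) := by
        simp only [hE, hq, Finset.mul_sum]
        exact Finset.sum_congr rfl fun s _ => Finset.sum_congr rfl fun t _ => by ring
      have e4 : ∑ s, π s * ∑ t, P s t * ∑ k ∈ Finset.range K,
          ε ^ 2 * 4 ^ k * min 1 ((L ^ 2 * d s t ^ 2 / (ε ^ 2 * 4 ^ k)) ^ 2) =
          ∑ k ∈ Finset.range K, ε ^ 2 * 4 ^ k *
            ∑ s, π s * ∑ t, P s t * min 1 ((L ^ 2 * d s t ^ 2 / (ε ^ 2 * 4 ^ k)) ^ 2) := by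
        simp only [Finset.mul_sum]
        rw [Finset.sum_comm' (t' := Finset.univ) (s' := fun _ => Finset.range K) (by simp)]
        refine Finset.sum_congr rfl fun s _ => ?_
        rw [Finset.sum_comm]
        exact Finset.sum_congr rfl fun t _ => Finset.sum_congr rfl fun k _ => by ring
      linarith
    have s3 : ∀ a b : ℕ → ℝ, ∑ k ∈ Finset.range K,
        ε ^ 2 * 4 ^ k * (8 * (130 * a k + 3584 * (n : ℝ) * b k)) =
        1040 * (∑ k ∈ Finset.range K, ε ^ 2 * 4 ^ k * a k) +
          28672 * (n : ℝ) * ∑ k ∈ Finset.range K, ε ^ 2 * 4 ^ k * b k := by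
      intro a b
      rw [Finset.mul_sum, Finset.mul_sum, ← Finset.sum_add_distrib]
      exact Finset.sum_congr rfl fun k _ => by ring
    rw [s3] at hsum
    have s4 := mul_le_mul_of_nonneg_left s2 (by positivity : (0 : ℝ) ≤ 28672 * n)
    -- the total constant is `4 * 8 * 4 * (130 * 4 + 3584) = 525312 ≤ 725 ^ 2`
    have hE0 : 0 ≤ L ^ 2 * (n * E) := mul_nonneg (by positivity) (mul_nonneg (by positivity)
      (Finset.sum_nonneg fun s _ => mul_nonneg (h.init_nonneg s) (hq0 s)))
    nlinarith
  refine le_of_forall_pos_le_add fun δ hδ => ?_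
  have := main (Real.sqrt δ) (Real.sqrt_pos.2 hδ)
  rwa [Real.sq_sqrt hδ.le] at this

end Scales

/-! ### From padded partitions to threshold maps -/

/-- A quarter of all sign patterns take two prescribed values at two prescribed points. -/
theorem card_signs_le {S : Type*} [Fintype S] [DecidableEq S] {a b : S} (hab : a ≠ b) :
    Fintype.card (S → Bool) ≤
      4 * (Finset.univ.filter fun σ : S → Bool => σ a = true ∧ σ b = false).card := by
  let F : (S → Bool) → (Bool × Bool) × {σ : S → Bool // σ a = true ∧ σ b = false} := fun σ =>
    ((σ a, σ b), ⟨Function.update (Function.update σ a true) b false, by simp [hab]⟩)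
  have hF : Function.Injective F := by
    intro σ σ' h
    simp only [F, Prod.mk.injEq, Subtype.mk.injEq] at h
    funext s
    by_cases hb : s = b
    · rw [hb]; exact h.1.2
    by_cases ha : s = a
    · rw [ha]; exact h.1.1
    have := congrFun h.2 s
    simpa [Function.update_of_ne, ha, hb] using this
  have := Fintype.card_le_of_injective F hF
  simpa [Fintype.card_subtype] using this

/-- The distance to a random union of clusters, truncated at the scale of the padding, is a
threshold map: if `s` is padded, its cluster is kept away from the union and the cluster of `t`
belongs to it, then the function separates `s` from `t`. -/
theorem hasThresholdMaps_of_partitions {S : Type} [Finite S] {X : Type*} {d : S → S → ℝ} {L : ℝ}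
    (hL : 0 < L) (hself : ∀ s, d s s = 0) (hnonneg : ∀ s t, 0 ≤ d s t)
    (hsymm : ∀ s t, d s t = d t s) (htri : ∀ s t u, d s u ≤ d s t + d t u)
    (hpart : ∀ τ : ℝ, 0 < τ → ∃ (ι : Type) (_ : Fintype ι) (_ : Nonempty ι) (c : ι → S → X),
      (∀ i s t, c i s = c i t → d s t < τ) ∧
      ∀ s, Fintype.card ι ≤ 2 * Nat.card {i // ∀ t, d s t < τ / L → c i t = c i s}) :
    HasThresholdMaps d L := by
  classical
  have := Fintype.ofFinite S
  intro τ hτ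
  obtain ⟨ι, _, _, c, hdiam, hpad⟩ := hpart τ hτ
  set w := τ / L with hw
  have hw0 : 0 < w := by positivity
  -- clusters are encoded by representatives in `S`
  have hrep : ∀ i, ∃ r : S → S, ∀ s t, r s = r t ↔ c i s = c i t := fun i =>
    ⟨fun s => Set.rangeSplitting (c i) ⟨c i s, Set.mem_range_self s⟩, fun s t =>
      (Set.rangeSplitting_injective (c i)).eq_iff.trans Subtype.ext_iff⟩
  choose r hr using hrep
  let val : ι × (S → Bool) → S → S → ℝ := fun p s u =>
    if p.2 (r p.1 u) = false then min (d s u) w else w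
  have hval0 : ∀ p s u, 0 ≤ val p s u := fun p s u => by
    simp only [val]
    split_ifs
    · exact le_min (hnonneg _ _) hw0.le
    · exact hw0.le
  let f : ι × (S → Bool) → S → ℝ := fun p s => Finset.univ.inf' ⟨s, Finset.mem_univ s⟩ (val p s)
  have hle : ∀ p s t, f p s ≤ f p t + min (d s t) w := by
    intro p s t
    obtain ⟨u, -, hu⟩ := Finset.exists_mem_eq_inf' (⟨t, Finset.mem_univ t⟩ : Finset.univ.Nonempty)
      (val p t)
    have h1 : f p s ≤ val p s u := Finset.inf'_le _ (Finset.mem_univ u)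
    have h2 : f p t = val p t u := hu
    have h3 : val p s u ≤ val p t u + min (d s t) w := by
      have h4 := htri s t u
      have h5 : 0 ≤ min (d s t) w := le_min (hnonneg _ _) hw0.le
      simp only [val]
      split_ifs
      · rcases min_cases (d s u) w with ⟨e1, _⟩ | ⟨e1, _⟩ <;>
          rcases min_cases (d t u) w with ⟨e2, _⟩ | ⟨e2, _⟩ <;>
          rcases min_cases (d s t) w with ⟨e3, _⟩ | ⟨e3, _⟩ <;>
          rw [e1, e2, e3] <;> linarith [hnonneg t u, hnonneg s t]
      · linarith
    linarith
  refine ⟨ι × (S → Bool), inferInstance, inferInstance, f, fun p s t => ?_, fun s t hst => ?_⟩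
  · rw [abs_le]
    have := hle p s t
    have := hle p t s
    rw [hsymm t s] at this
    constructor <;> linarith
  have hgood : ∀ i, (∀ u, d s u < w → c i u = c i s) → ∀ σ : S → Bool,
      σ (r i s) = true → σ (r i t) = false → w ≤ |f (i, σ) s - f (i, σ) t| := by
    intro i hi σ hs ht
    have h1 : f (i, σ) t ≤ 0 := by
      refine (Finset.inf'_le _ (Finset.mem_univ t)).trans ?_
      simp only [val, ht, if_true, hself]
      exact min_le_left _ _
    have h2 : w ≤ f (i, σ) s := by
      refine Finset.le_inf' _ _ fun u _ => ?_
      simp only [val]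
      split_ifs with hu
      · refine le_min ?_ le_rfl
        by_contra hlt
        have := (hr i u s).2 (hi u (not_le.1 hlt))
        rw [this, hs] at hu
        exact Bool.noConfusion hu
      · exact le_rfl
    exact le_trans (by linarith) (le_abs_self _)
  have hsub : ((Finset.univ.filter fun i => ∀ u, d s u < w → c i u = c i s).sigma fun i =>
      Finset.univ.filter fun σ : S → Bool => σ (r i s) = true ∧ σ (r i t) = false).card ≤
      (Finset.univ.filter fun p => w ≤ |f p s - f p t|).card := by
    refine Finset.card_le_card_of_injOn (fun a => (a.1, a.2)) ?_ ?_
    · rintro ⟨i, σ⟩ h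
      simp only [Finset.coe_sigma, Finset.coe_filter, Finset.mem_univ, true_and,
        Set.mem_sigma_iff, Set.mem_ofPred_eq] at h ⊢
      exact hgood i h.1 σ h.2.1 h.2.2
    · rintro ⟨i, σ⟩ _ ⟨i', σ'⟩ _ h
      obtain ⟨rfl, rfl⟩ := Prod.mk.inj h
      rfl
  have hsum : (Finset.univ.filter fun i => ∀ u, d s u < w → c i u = c i s).card *
      Fintype.card (S → Bool) ≤
      4 * ((Finset.univ.filter fun i => ∀ u, d s u < w → c i u = c i s).sigma fun i =>
      Finset.univ.filter fun σ : S → Bool => σ (r i s) = true ∧ σ (r i t) = false).card := by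
    rw [Finset.card_sigma, Finset.mul_sum, ← smul_eq_mul]
    refine Finset.card_nsmul_le_sum _ _ _ fun i _ => card_signs_le fun h => ?_
    exact (hdiam i s t ((hr i s t).1 h)).not_ge hst
  have hp := hpad s
  rw [Nat.card_eq_fintype_card, Fintype.card_subtype] at hp ⊢
  rw [Fintype.card_prod]
  calc Fintype.card ι * Fintype.card (S → Bool)
      ≤ 2 * _ * Fintype.card (S → Bool) := Nat.mul_le_mul_right _ hp
    _ = 2 * (_ * Fintype.card (S → Bool)) := mul_assoc _ _ _
    _ ≤ 2 * (4 * _) := Nat.mul_le_mul_left _ (hsum.trans (Nat.mul_le_mul_left _ hsub))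
    _ = 8 * _ := by ring

/-! ### Threshold maps on weighted planar graphs -/

namespace Graph

variable {α β : Type*} {G : Graph α β} {ω : V(G) → ℝ≥0}

theorem weightedDist_le_of_adj {x y : V(G)} (h : G.Adj x y) :
    G.weightedDist ω x y ≤ ((ω y + ω x) / 2 : ℝ≥0) := by
  refine iInf_le_of_le 1 (iInf_le_of_le (fun i => if i = 0 then x else y) (iInf_le_of_le
    ⟨rfl, rfl, fun i hi => ?_⟩ ?_))
  · obtain rfl : i = 0 := by omega
    exact Or.inr h
  · simp [weightedLength]

variable (G ω)

/-- The graph `G` with the weighted edge lengths rounded up to multiples of `δ`, without the edges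
whose rounded length is more than `W * δ`. -/
noncomputable def roundedGraph (δ : ℝ) (W : ℕ) : LengthGraph V(G) W where
  Adj x y := G.Adj x y ∧ ⌊((ω x + ω y : ℝ)) / 2 / δ⌋₊ + 1 ≤ W
  symm h := ⟨h.1.symm, by rw [add_comm (ω _ : ℝ)]; exact h.2⟩
  len x y := ⌊((ω x + ω y : ℝ)) / 2 / δ⌋₊ + 1
  len_comm x y := by rw [add_comm (ω x : ℝ)]
  one_le_len _ := Nat.le_add_left 1 _
  len_le h := h.2

variable {G ω}

theorem weightedDist_le_of_walk {δ : ℝ} (hδ : 0 < δ) {W n : ℕ} {x y : V(G)}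
    (h : (G.roundedGraph ω δ W).Walk Set.univ x n y) :
    G.weightedDist ω x y ≤ ENNReal.ofReal (n * δ) := by
  induction h with
  | nil _ => rw [weightedDist_self]; exact zero_le
  | @snoc n y z hw ha _ ih =>
    refine (weightedDist_triangle G ω x y z).trans ?_
    rw [Nat.cast_add, add_mul, ENNReal.ofReal_add (by positivity) (by positivity)]
    refine add_le_add ih ((weightedDist_le_of_adj ha.1).trans ?_)
    rw [← ENNReal.ofReal_coe_nnreal]
    refine ENNReal.ofReal_le_ofReal ?_
    have : (((ω y + ω z : ℝ)) / 2 / δ) ≤ (G.roundedGraph ω δ W).len y z := by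
      simp only [roundedGraph]
      push_cast
      exact (Nat.lt_floor_add_one _).le
    rw [div_le_iff₀ hδ] at this
    push_cast
    linarith

/-- A path of weighted length at most `W * δ`, with some room for the rounding errors, is a walk of
length at most `W` of the rounded graph. -/
theorem IsLazyPath.exists_walk {δ : ℝ} (hδ : 0 < δ) {W n : ℕ} {x y : V(G)} {p : ℕ → V(G)}
    (hp : G.IsLazyPath x y n p) (hW : (weightedLength ω n p : ℝ) / δ + n ≤ W) :
    ∃ k ≤ W, (G.roundedGraph ω δ W).Walk Set.univ x k y := by
  have key : ∀ j ≤ n, ∃ k : ℕ, (k : ℝ) ≤ (weightedLength ω j p : ℝ) / δ + j ∧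
      (G.roundedGraph ω δ W).Walk Set.univ x k (p j) := by
    intro j
    induction j with
    | zero => exact fun _ => ⟨0, by simp [weightedLength], by rw [hp.start]; exact .nil trivial⟩
    | succ j ih =>
      intro hj
      obtain ⟨k, hk, hw⟩ := ih (by omega)
      have e : (weightedLength ω (j + 1) p : ℝ) =
          weightedLength ω j p + (ω (p j) + ω (p (j + 1))) / 2 := by
        unfold weightedLength
        rw [Finset.sum_range_succ]
        push_cast
        ring
      have hedge0 : (0 : ℝ) ≤ (ω (p j) + ω (p (j + 1))) / 2 / δ := by positivity
      have hfl := Nat.floor_le hedge0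
      rcases hp.step j hj with heq | hadj
      · refine ⟨k, ?_, heq ▸ hw⟩
        rw [e, add_div]
        push_cast
        linarith
      · have hbound : (weightedLength ω (j + 1) p : ℝ) ≤ weightedLength ω n p := by
          unfold weightedLength
          exact_mod_cast Finset.sum_le_sum_of_subset (Finset.range_subset_range.2 hj)
        have hbound' := div_le_div_of_nonneg_right hbound hδ.le
        have hjn : ((j + 1 : ℕ) : ℝ) ≤ n := by exact_mod_cast hj
        have hl0 : (0 : ℝ) ≤ weightedLength ω j p / δ := by positivity
        rw [e, add_div] at hbound'
        push_cast at hjn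
        refine ⟨k + (G.roundedGraph ω δ W).len (p j) (p (j + 1)), ?_,
          hw.snoc ⟨hadj, ?_⟩ trivial⟩
        · rw [e, add_div]
          simp only [roundedGraph]
          push_cast
          linarith
        · have : ((⌊((ω (p j) + ω (p (j + 1)) : ℝ)) / 2 / δ⌋₊ + 1 : ℕ) : ℝ) ≤ W := by
            push_cast
            have : (0 : ℝ) ≤ j := Nat.cast_nonneg j
            linarith
          exact_mod_cast this
  obtain ⟨k, hk, hw⟩ := key n le_rfl
  rw [hp.finish] at hw
  exact ⟨k, by exact_mod_cast hk.trans hW, hw⟩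

theorem IsPlanar.roundedGraph_not_isK33Minor (hG : G.IsPlanar) (δ : ℝ) (W : ℕ)
    (A B : Fin 3 → Set V(G)) : ¬ IsK33Minor (G.roundedGraph ω δ W).Adj A B := by
  intro h
  have hmono : ∀ {H : Set V(G)} {x y}, ConnectedWithin (G.roundedGraph ω δ W).Adj H x y →
      ConnectedWithin (fun x y : V(G) => G.Adj x y) H x y := fun {H} {x y} hxy => by
    unfold ConnectedWithin at hxy ⊢
    exact Relation.ReflTransGen.mono
      (fun a b (hab : (G.roundedGraph ω δ W).Adj a b ∧ b ∈ H) => ⟨hab.1.1, hab.2⟩) _ _ hxy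
  refine hG.not_isK33Minor A B
    { h with
      connected_left := fun i x hx y hy => hmono (h.connected_left i x hx y hy)
      connected_right := fun i x hx y hy => hmono (h.connected_right i x hx y hy)
      adj := fun i l => ?_ }
  obtain ⟨x, hx, y, hy, hxy⟩ := h.adj i l
  exact ⟨x, hx, y, hy, hxy.1⟩

/-- Finite sets at finite distances in a weighted planar graph have threshold maps with a universal
constant. -/
theorem IsPlanar.hasThresholdMaps (hG : G.IsPlanar) {S : Type} [Finite S]
    (φ : S → G.WeightedSpace ω) (hφ : ∀ s t, edist (φ s) (φ t) ≠ ⊤) :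
    HasThresholdMaps (fun s t => (edist (φ s) (φ t)).toReal) 1201 := by
  refine hasThresholdMaps_of_partitions (X := Set V(G)) (by norm_num) (fun s => by simp)
    (fun s t => ENNReal.toReal_nonneg) (fun s t => by rw [edist_comm])
    (fun s t u => ?_) fun τ hτ => ?_
  · rw [← ENNReal.toReal_add (hφ _ _) (hφ _ _)]
    exact ENNReal.toReal_mono (ENNReal.add_ne_top.2 ⟨hφ _ _, hφ _ _⟩) (edist_triangle _ _ _)
  set w : ℝ := τ / 1201 with hw
  have hw0 : 0 < w := by positivity
  -- a rounding so fine that short distances are witnessed by walks of length at most `W`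
  have hev : ∀ p : S × S, ∀ᶠ W : ℕ in Filter.atTop,
      (edist (φ p.1) (φ p.2)).toReal < w → ∃ n q, G.IsLazyPath (φ p.1) (φ p.2) n q ∧
        (weightedLength ω n q : ℝ) / (w / W) + n ≤ W := by
    intro p
    by_cases hp : (edist (φ p.1) (φ p.2)).toReal < w
    · have hp' : G.weightedDist ω (φ p.1) (φ p.2) < ENNReal.ofReal w :=
        (ENNReal.lt_ofReal_iff_toReal_lt (hφ _ _)).2 hp
      unfold weightedDist at hp'
      simp only [iInf_lt_iff] at hp'
      obtain ⟨n, q, hq, hlt⟩ := hp'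
      have hlt' : (weightedLength ω n q : ℝ) < w := by
        rw [ENNReal.lt_ofReal_iff_toReal_lt ENNReal.coe_ne_top] at hlt
        simpa using hlt
      have hpos : 0 < 1 - weightedLength ω n q / w := by
        rw [sub_pos, div_lt_one hw0]; exact hlt'
      obtain ⟨W₀, hW₀⟩ := exists_nat_gt (n / (1 - weightedLength ω n q / w))
      filter_upwards [Filter.eventually_ge_atTop W₀] with W hW _
      refine ⟨n, q, hq, ?_⟩
      have h1 : n / (1 - weightedLength ω n q / w) ≤ (W : ℝ) :=
        hW₀.le.trans (by exact_mod_cast hW)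
      rw [div_le_iff₀ hpos] at h1
      have h2 : (weightedLength ω n q : ℝ) / (w / W) = W * (weightedLength ω n q / w) := by
        field_simp
      rw [h2]
      linarith
    · exact Filter.Eventually.of_forall fun W h => absurd h hp
  obtain ⟨W, hWpos, hWpath⟩ :=
    ((Filter.eventually_gt_atTop 0).and (Filter.eventually_all.2 hev)).exists
  have hW0 : (0 : ℝ) < W := by exact_mod_cast hWpos
  have hδ : 0 < w / W := by positivity
  obtain ⟨ι, i1, i2, cl, hdiam, hpad⟩ := (G.roundedGraph ω (w / W) W).exists_padded_partitions hWpos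
    (hG.roundedGraph_not_isK33Minor _ _)
  refine ⟨ι, i1, i2, fun i s => cl i (φ s), fun i s t hst => ?_, fun s => ?_⟩
  · obtain ⟨n, hn, hwalk⟩ := hdiam i _ _ hst
    have h1 : edist (φ s) (φ t) ≤ ENNReal.ofReal (n * (w / W)) := weightedDist_le_of_walk hδ hwalk
    have h2 := ENNReal.toReal_le_of_le_ofReal (by positivity) h1
    have h3 : (n : ℝ) ≤ 1200 * W := by exact_mod_cast hn
    have h4 := mul_le_mul_of_nonneg_right h3 hδ.le
    have h5 : 1200 * W * (w / W) = 1200 * w := by field_simp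
    rw [h5] at h4
    have h6 : τ = 1201 * w := by rw [hw]; ring
    linarith
  · classical
    refine (hpad (φ s)).trans (Nat.mul_le_mul_left _ ?_)
    rw [Nat.card_eq_fintype_card, Fintype.card_subtype]
    refine Finset.card_le_card fun i hi => ?_
    simp only [Finset.mem_filter, Finset.mem_univ, true_and] at hi ⊢
    intro t ht
    obtain ⟨n, q, hq, hle⟩ := hWpath (s, t) ht
    obtain ⟨k, hk, hwalk⟩ := hq.exists_walk hδ hle
    exact hi k hk _ hwalk

end Graph

/-! ### Maximal Markov type from threshold maps -/

section Law

variable {S : Type*} [Fintype S] {P : Matrix S S ℝ} {π : S → ℝ}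

/-- The integral of a function of the first `n + 1` states as a finite sum over trajectories. -/
theorem IsMarkovChain.lintegral_eq {Ω : Type*} [MeasurableSpace Ω] {μ : MeasureTheory.Measure Ω}
    {X : ℕ → Ω → S} (hX : IsMarkovChain π P μ X) {n : ℕ} {g : (ℕ → S) → ℝ≥0∞}
    (hg : DependsOn g (Set.Iic n)) :
    ∫⁻ a, g (fun i => X i a) ∂μ = ∑ y : Fin (n + 1) → S,
      ENNReal.ofReal (trajectoryWeight P π y) * g (extendTrajectory y) := by
  let : MeasurableSpace (Fin (n + 1) → S) := ⊤
  set Y : Ω → Fin (n + 1) → S := fun a i => X i a with hY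
  have hpre : ∀ y : Fin (n + 1) → S, Y ⁻¹' {y} = {a | ∀ i ≤ n, X i a = extendTrajectory y i} := by
    intro y
    ext a
    constructor
    · intro h i hi
      have h1 : Y a = y := h
      simp only [extendTrajectory, ← h1, hY, min_eq_left hi]
    · intro h
      refine funext fun i => ?_
      have h1 := h i (Nat.lt_succ_iff.1 i.2)
      simp only [extendTrajectory, min_eq_left (Nat.lt_succ_iff.1 i.2)] at h1
      exact h1
  have hmeas : ∀ y : Fin (n + 1) → S, MeasurableSet (Y ⁻¹' {y}) := fun y => by
    have : Y ⁻¹' {y} = ⋂ i : Fin (n + 1), {a | X i a = y i} := by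
      ext a
      simp only [Set.mem_preimage, Set.mem_singleton_iff, Set.mem_iInter, Set.mem_ofPred_eq, hY]
      exact funext_iff
    rw [this]
    exact MeasurableSet.iInter fun i => hX.measurable _ _
  have hYm : Measurable Y := measurable_to_countable' hmeas
  have hfac : ∀ a, g (fun i => X i a) = g (extendTrajectory (Y a)) := fun a => hg fun i hi => by
    simp only [extendTrajectory, hY, min_eq_left (Set.mem_Iic.1 hi)]
  simp only [hfac]
  rw [← MeasureTheory.lintegral_map (f := fun y => g (extendTrajectory y)) measurable_from_top hYm,
    MeasureTheory.lintegral_fintype]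
  refine Finset.sum_congr rfl fun y _ => ?_
  rw [MeasureTheory.Measure.map_apply hYm (measurableSet_singleton y), hpre, hX.law n, mul_comm,
    Finset.prod_range]
  congr 3
  refine Finset.prod_congr rfl fun i _ => ?_
  have e : ∀ (k : ℕ) (hk : k < n + 1), extendTrajectory y k = y ⟨k, hk⟩ := fun k hk => by
    simp only [extendTrajectory, min_eq_left (Nat.lt_succ_iff.1 hk)]
  rw [e i (by omega), e (i + 1) (by omega)]
  rfl

variable [DecidableEq S]

theorem IsIrreducibleReversible.isReversibleChain (h : IsIrreducibleReversible P π) :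
    IsReversibleChain P π where
  nonneg := h.irreducible.nonneg
  row_sum s := by
    have := congrFun (Matrix.mem_rowStochastic.1 h.stochastic).2 s
    simpa [Matrix.mulVec, dotProduct] using this
  init_nonneg := h.prob.1
  init_sum := h.prob.2
  detailed_balance := h.detailed_balance

/-- A property of states that is preserved by all possible transitions of an irreducible chain
holds everywhere if it holds somewhere. -/
theorem IsIrreducibleReversible.induction (h : IsIrreducibleReversible P π) {Q : S → Prop} {s : S}
    (hs : Q s) (hstep : ∀ a b, 0 < P a b → Q a → Q b) (t : S) : Q t := by
  let := Matrix.toQuiver P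
  obtain ⟨p, -⟩ := h.irreducible.connected s t
  induction p with
  | nil => exact hs
  | cons _ e ih => exact hstep _ _ e.down ih

theorem IsIrreducibleReversible.init_pos (h : IsIrreducibleReversible P π) (s : S) : 0 < π s := by
  obtain ⟨a, -, ha⟩ : ∃ a ∈ Finset.univ, 0 < π a := by
    apply Finset.exists_lt_of_sum_lt
    simp [h.prob.2]
  refine h.induction (Q := fun s => 0 < π s) ha (fun a b hab ha => ?_) s
  have h1 : 0 < π b * P b a := h.detailed_balance a b ▸ mul_pos ha hab
  exact (h.prob.1 b).lt_of_ne fun h0 => by rw [← h0, zero_mul] at h1; exact lt_irrefl _ h1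

end Law

theorem hasMaximalMarkovTypeWith_of_thresholdMaps {E : Type*} [PseudoEMetricSpace E] {L : ℝ≥0}
    (hL : 0 < L) (hE : ∀ (S : Type) [Finite S] (φ : S → E), (∀ s t, edist (φ s) (φ t) ≠ ⊤) →
      HasThresholdMaps (fun s t => (edist (φ s) (φ t)).toReal) L) :
    HasMaximalMarkovTypeWith E 2 (725 * L) := by
  intro S _ _ P π hP Ω _ μ _ X hX φ n
  have h := hP.isReversibleChain
  rcases Nat.eq_zero_or_pos n with rfl | hn
  · simp
  have hstep := hX.lintegral_eq (n := 1) (g := fun x => edist (φ (x 0)) (φ (x 1)) ^ (2 : ℝ))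
    (fun x x' hx => by
      simp only [hx 0 (Set.mem_Iic.2 zero_le_one), hx 1 (Set.mem_Iic.2 le_rfl)])
  by_cases htop : ∫⁻ a, edist (φ (X 0 a)) (φ (X 1 a)) ^ (2 : ℝ) ∂μ = ⊤
  · rw [htop, ENNReal.mul_top]
    · exact le_top
    · have : (725 * L : ℝ≥0) ≠ 0 := by positivity
      have : ((725 * L : ℝ≥0) : ℝ≥0∞) ^ (2 : ℝ) ≠ 0 := by
        simpa using this
      exact mul_ne_zero this (by exact_mod_cast hn.ne')
  -- by irreducibility, all distances are finite
  have hfin1 : ∀ a b, 0 < P a b → edist (φ a) (φ b) ≠ ⊤ := by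
    intro a b hab hab'
    apply htop
    rw [hstep]
    refine ENNReal.sum_eq_top.2 ⟨![a, b], Finset.mem_univ _, ?_⟩
    have e0 : (extendTrajectory ![a, b] : ℕ → S) 0 = a := rfl
    have e1 : (extendTrajectory ![a, b] : ℕ → S) 1 = b := rfl
    rw [e0, e1, hab', ENNReal.top_rpow_of_pos two_pos, ENNReal.mul_top]
    have : 0 < π a * P a b := mul_pos (hP.init_pos a) hab
    simpa [trajectoryWeight] using this
  have hfin : ∀ a b, edist (φ a) (φ b) ≠ ⊤ := fun a =>
    hP.induction (Q := fun b => edist (φ a) (φ b) ≠ ⊤) (s := a) (by simp) fun b c hbc hb =>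
      ((edist_triangle _ _ _).trans_lt (ENNReal.add_lt_top.2
        ⟨hb.lt_top, (hfin1 b c hbc).lt_top⟩)).ne
  set d : S → S → ℝ := fun s t => (edist (φ s) (φ t)).toReal with hd
  have hsq : ∀ s t, edist (φ s) (φ t) ^ (2 : ℝ) = ENNReal.ofReal (d s t ^ 2) := fun s t => by
    rw [ENNReal.ofReal_pow ENNReal.toReal_nonneg, ENNReal.ofReal_toReal (hfin s t)]
    exact_mod_cast ENNReal.rpow_natCast _ 2
  -- the time of maximal displacement
  have hT : ∀ x : ℕ → S, ∃ k ≤ n, (Finset.range (n + 1)).sup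
      (fun m => edist (φ (x 0)) (φ (x m)) ^ (2 : ℝ)) = ENNReal.ofReal (d (x 0) (x k) ^ 2) := by
    intro x
    obtain ⟨k, hk, he⟩ := Finset.exists_mem_eq_sup (Finset.range (n + 1))
      Finset.nonempty_range_add_one fun m => edist (φ (x 0)) (φ (x m)) ^ (2 : ℝ)
    exact ⟨k, Nat.lt_succ_iff.1 (Finset.mem_range.1 hk), he.trans (hsq _ _)⟩
  choose T hTn hT using hT
  have hmax := hX.lintegral_eq (n := n) (g := fun x => (Finset.range (n + 1)).sup
      (fun m => edist (φ (x 0)) (φ (x m)) ^ (2 : ℝ)))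
    (fun x x' hx => Finset.sup_congr rfl fun m hm => by
      rw [hx 0 (Set.mem_Iic.2 (Nat.zero_le n)),
        hx m (Set.mem_Iic.2 (Nat.lt_succ_iff.1 (Finset.mem_range.1 hm)))])
  have hofReal : ∀ (k : ℕ) (F : (ℕ → S) → ℝ), (∀ x, 0 ≤ F x) → ∑ y : Fin (k + 1) → S,
      ENNReal.ofReal (trajectoryWeight P π y) * ENNReal.ofReal (F (extendTrajectory y)) =
      ENNReal.ofReal (trajectoryExpectation P π k F) := by
    intro k F hF
    unfold trajectoryExpectation
    rw [ENNReal.ofReal_sum_of_nonneg fun y _ => mul_nonneg (h.weight_nonneg y) (hF _)]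
    exact Finset.sum_congr rfl fun y _ => (ENNReal.ofReal_mul (h.weight_nonneg y)).symm
  simp only [hT] at hmax
  simp only [hsq] at hstep
  rw [hofReal n (fun x => d (x 0) (x (T x)) ^ 2) fun x => sq_nonneg _] at hmax
  rw [hofReal 1 (fun x => d (x 0) (x 1) ^ 2) fun x => sq_nonneg _,
    h.stationary_pair zero_lt_one fun s t => d s t ^ 2] at hstep
  rw [hmax]
  simp only [hsq]
  rw [hstep]
  have hC : ((725 * L : ℝ≥0) : ℝ≥0∞) ^ (2 : ℝ) * n = ENNReal.ofReal ((725 * L) ^ 2 * n) := by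
    rw [ENNReal.ofReal_mul (by positivity), ENNReal.ofReal_natCast, ENNReal.ofReal_pow
      (by positivity)]
    congr 1
    rw [← ENNReal.rpow_natCast, ← ENNReal.ofReal_coe_nnreal]
    push_cast
    rfl
  rw [hC, ← ENNReal.ofReal_mul (by positivity)]
  exact ENNReal.ofReal_le_ofReal (h.displacement_sq_le (by exact_mod_cast hL)
    (fun s t => ENNReal.toReal_nonneg) (hE S φ hfin) hn T hTn)

theorem proposition2p3 :
    ∃ C : ℝ≥0, ∀ (α β : Type*) (G : Graph α β) (ω : V(G) → ℝ≥0), G.IsPlanar →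
      HasMaximalMarkovType (G.WeightedSpace ω) 2 ∧
        maximalMarkovTypeConst (G.WeightedSpace ω) 2 ≤ C := by
  refine ⟨725 * 1201, fun α β G ω hG => ?_⟩
  have h : HasMaximalMarkovTypeWith (G.WeightedSpace ω) 2 (725 * 1201) :=
    hasMaximalMarkovTypeWith_of_thresholdMaps (by norm_num) fun S _ φ hφ =>
      hG.hasThresholdMaps φ hφ
  exact ⟨⟨_, h⟩, iInf₂_le _ h⟩
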